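/- **Setting.** A *dual pair* $(X,\mathcal F)$ consists of a Banach space $X$ and a norm-closed subspace $\mathcal F$ of $X^*$ such that: $\|x\|=\sup\{|\varphi(x)|:\varphi\in\mathcal F,\ \|\varphi\|\le 1\}$ for $x\in X$ and $\|\varphi\|=\sup\{|\varphi(x)|:x\in X,\ \|x\|\le 1\}$ for $\varphi\in\mathcal F$; the convex hull of every relatively $\sigma(X,\mathcal F)$-compact subset of $X$ is relatively $\sigma(X,\mathcal F)$-compact; and the convex hull of every relatively $\sigma(\mathcal F,X)$-compact subset of $\mathcal F$ is relatively $\sigma(\mathcal F,X)$-compact. The topology $\sigma(X,\mathcal F)$ is called the $\mathcal F$-topology, and $\overline{S}^{\sigma}$ denotes the closure of $S$ in it. On $X\otimes M_n(\mathbb C)=M_n(X)$ the $\mathcal F$-topology is the weak topology defined by $\mathcal F\otimes M_n(\mathbb C)^*$ (entrywise $\mathcal F$-convergence). An *$\mathcal F$-dynamical system* $(X,G,\alpha)$ consists of a dual pair $(X,\mathcal F)$ in which $X$ is a (not necessarily unital) C*-algebra whose involution is $\mathcal F$-continuous and whose multiplication is separately $\mathcal F$-continuous, a compact (Hausdorff)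 group $G$, and a homomorphism $\alpha$ from $G$ to the group of $*$-automorphisms of $X$ such that every $\alpha_g$ is $\mathcal F$-continuous and $g\mapsto\varphi(\alpha_g(x))$ is continuous for all $x\in X$, $\varphi\in\mathcal F$. Put $X^\alpha=\{x\in X:\alpha_g(x)=x\text{ for all }g\in G\}$. Let $\widehat G$ be the set of unitary equivalence classes of (continuous) irreducible unitary representations of $G$; for each class fix a representative $\pi$, on the finite-dimensional Hilbert space $H_\pi$. Products of sets of algebra elements denote the linear spans of the products of their elements. For an $\alpha$-invariant $\mathcal F$-closed C*-subalgebra $Y$ of $X$ and $\pi\in\widehat G$, let $$Y_2(\pi)=\{a\in Y\otimes B(H_\pi):(\alpha_g\otimes\iota)(a)=a(1\otimes\pi_g)\ \text{for all } g\in G\},$$ where $\iota$ is the identity map of $B(H_\pi)$, and let $(Y\otimes B(H_\pi))^{\alpha\otimes \mathrm{ad}\,\pi}$ be the set of all $a\in Y\otimes B(H_\pi)$ with $(1\otimes\pi_g)\,(\alpha_g\otimes\iota)(a)\,(1\otimes\pi_{g^{-1}})=a$ for all $g\in G$. The spectrum $sp_{\mathcal F}(\alpha|_Y)$ is the set of those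 $\pi\in\widehat G$ for which the ideal $\overline{Y_2(\pi)^*Y_2(\pi)}^{\sigma}$ is essential in $(Y\otimes B(H_\pi))^{\alpha\otimes \mathrm{ad}\,\pi}$, i.e. has zero annihilator there. The *Connes spectrum* of $\alpha$ is $$\Gamma_{\mathcal F}(\alpha)=\bigcap\{sp_{\mathcal F}(\alpha|_Y): Y\in\mathcal H^\alpha_\sigma(X)\},$$ where $\mathcal H^\alpha_\sigma(X)$ is the set of all nonzero $\alpha$-invariant $\mathcal F$-closed hereditary C*-subalgebras of $X$. (Intersections of families of subsets of $\widehat G$ are taken in $\widehat G$.) **Theorem 4.1.** Let $(X,G,\alpha)$ be an $\mathcal F$-dynamical system. Then $$\Gamma_{\mathcal F}(\alpha)=\bigcap\{sp_{\mathcal F}(\alpha|_{\overline{JXJ}^{\sigma}}): J\subset X^\alpha\text{ a nonzero }\mathcal F\text{-closed two-sided ideal of }X^\alpha\}.$$ -/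

import Mathlib

open scoped Topology

/-! ### Dual pairs of Banach spaces and the `F`-topologies -/

section DualPair

variable {X : Type*} [NormedAddCommGroup X] [NormedSpace ℂ X]

/-- The `F`-topology on `X`, i.e. `σ(X, F)`: the coarsest topology making every `φ ∈ F`
continuous. -/
noncomputable abbrev weakTop (F : Submodule ℂ (StrongDual ℂ X)) : TopologicalSpace X :=
  TopologicalSpace.induced (fun (x : X) (φ : F) => (φ : StrongDual ℂ X) x) Pi.topologicalSpace

/-- The `X`-topology on `F`, i.e. `σ(F, X)`: the topology of pointwise convergence on `X`. -/
noncomputable abbrev weakStarTop (F : Submodule ℂ (StrongDual ℂ X)) : TopologicalSpace F :=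
  TopologicalSpace.induced (fun (φ : F) (x : X) => (φ : StrongDual ℂ X) x) Pi.topologicalSpace

/-- The `F`-topology on `X ⊗ Mₙ(ℂ) = Mₙ(X)`, i.e. the weak topology defined by `F ⊗ Mₙ(ℂ)*`: the
coarsest topology making all the maps `a ↦ φ (a i j)`, `φ ∈ F`, continuous. -/
noncomputable abbrev weakMatrixTop (F : Submodule ℂ (StrongDual ℂ X)) (n : ℕ) :
    TopologicalSpace (Matrix (Fin n) (Fin n) X) :=
  TopologicalSpace.induced
    (fun (a : Matrix (Fin n) (Fin n) X) (p : F × Fin n × Fin n) =>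
      (p.1 : StrongDual ℂ X) (a p.2.1 p.2.2)) Pi.topologicalSpace

/-- `(X, F)` is a dual pair of Banach spaces (completeness of `X` is a separate instance). A set is
relatively compact when its closure is compact. -/
structure IsDualPair (F : Submodule ℂ (StrongDual ℂ X)) : Prop where
  /-- `F` is a Banach subspace of the dual of `X`. -/
  isClosed : IsClosed (F : Set (StrongDual ℂ X))
  /-- `F` is norming for `X`. -/
  norm_eq_left : ∀ x : X, IsLUB {r : ℝ | ∃ φ ∈ F, ‖φ‖ ≤ 1 ∧ r = ‖φ x‖} ‖x‖
  /-- `X` is norming for `F`. -/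
  norm_eq_right : ∀ φ ∈ F, IsLUB {r : ℝ | ∃ x : X, ‖x‖ ≤ 1 ∧ r = ‖φ x‖} ‖φ‖
  /-- The convex hull of a relatively `F`-compact subset of `X` is relatively `F`-compact. -/
  convexHull_left : ∀ K : Set X, @IsCompact X (weakTop F) (closure[weakTop F] K) →
    @IsCompact X (weakTop F) (closure[weakTop F] (convexHull ℝ K))
  /-- The convex hull of a relatively `X`-compact subset of `F` is relatively `X`-compact. -/
  convexHull_right : ∀ K : Set F, @IsCompact F (weakStarTop F) (closure[weakStarTop F] K) →
    @IsCompact F (weakStarTop F) (closure[weakStarTop F] (convexHull ℝ K))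

end DualPair

/-! ### The dual `Ĝ` of a compact group -/

section UnitaryDual

/-- A continuous irreducible unitary representation of `G` on `ℂᵈ`, written in matrix form. (For a
compact group every irreducible unitary representation is unitarily equivalent to one of these.) -/
structure UnitaryIrrep (G : Type*) [Group G] [TopologicalSpace G] where
  /-- The dimension `d`. -/
  dim : ℕ
  /-- The homomorphism `G → U(d)`. -/
  hom : G →* Matrix.unitaryGroup (Fin dim) ℂ
  continuous_hom : Continuous hom
  dim_pos : 0 < dim
  /-- The only invariant subspaces of `ℂᵈ` are the trivial ones. -/
  irreducible : ∀ W : Submodule ℂ (Fin dim → ℂ),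
    (∀ g, ∀ w ∈ W, (hom g : Matrix (Fin dim) (Fin dim) ℂ).mulVec w ∈ W) → W = ⊥ ∨ W = ⊤

variable {G : Type*} [Group G] [TopologicalSpace G]

/-- The unitary matrix `π_g`. -/
def UnitaryIrrep.mat (π : UnitaryIrrep G) (g : G) : Matrix (Fin π.dim) (Fin π.dim) ℂ := π.hom g

/-- Unitary equivalence: a unitary `U` with `π_g U = U ρ_g` for all `g`. -/
def UnitaryIrrep.Equivalent (π ρ : UnitaryIrrep G) : Prop :=
  ∃ U : Matrix (Fin π.dim) (Fin ρ.dim) ℂ,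
    U * U.conjTranspose = 1 ∧ U.conjTranspose * U = 1 ∧ ∀ g, π.mat g * U = U * ρ.mat g

theorem UnitaryIrrep.equivalent_equivalence :
    Equivalence (UnitaryIrrep.Equivalent (G := G)) where
  refl π := ⟨1, by simp, by simp, by simp⟩
  symm := by
    rintro π ρ ⟨U, h1, h2, h3⟩
    refine ⟨U.conjTranspose, by simpa using h2, by simpa using h1, fun g => ?_⟩
    calc ρ.mat g * U.conjTranspose
        = (U.conjTranspose * U) * ρ.mat g * U.conjTranspose := by rw [h2, Matrix.one_mul]
      _ = U.conjTranspose * (U * ρ.mat g) * U.conjTranspose := by simp only [Matrix.mul_assoc]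
      _ = U.conjTranspose * (π.mat g * U) * U.conjTranspose := by rw [h3]
      _ = U.conjTranspose * π.mat g * (U * U.conjTranspose) := by simp only [Matrix.mul_assoc]
      _ = U.conjTranspose * π.mat g := by rw [h1, Matrix.mul_one]
  trans := by
    rintro π ρ σ ⟨U, h1, h2, h3⟩ ⟨V, k1, k2, k3⟩
    refine ⟨U * V, ?_, ?_, fun g => ?_⟩
    · calc U * V * (U * V).conjTranspose
          = U * (V * V.conjTranspose) * U.conjTranspose := by
            simp only [Matrix.conjTranspose_mul, Matrix.mul_assoc]
        _ = 1 := by rw [k1, Matrix.mul_one, h1]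
    · calc (U * V).conjTranspose * (U * V)
          = V.conjTranspose * (U.conjTranspose * U) * V := by
            simp only [Matrix.conjTranspose_mul, Matrix.mul_assoc]
        _ = 1 := by rw [h2, Matrix.mul_one, k2]
    · rw [← Matrix.mul_assoc, h3, Matrix.mul_assoc, k3, Matrix.mul_assoc]

/-- The setoid of unitary equivalence. -/
def unitaryIrrepSetoid (G : Type*) [Group G] [TopologicalSpace G] : Setoid (UnitaryIrrep G) :=
  ⟨UnitaryIrrep.Equivalent, UnitaryIrrep.equivalent_equivalence⟩

/-- `Ĝ`: the set of unitary equivalence classes of irreducible unitary representations of `G`. -/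
def UnitaryDual (G : Type*) [Group G] [TopologicalSpace G] : Type _ :=
  Quotient (unitaryIrrepSetoid G)

/-- The fixed representative of a class. -/
noncomputable def UnitaryDual.rep (π : UnitaryDual G) : UnitaryIrrep G :=
  Quotient.out (s := unitaryIrrepSetoid G) π

end UnitaryDual

/-! ### `F`-dynamical systems and their spectra -/

section Dynamics

variable {X : Type*} [NonUnitalCStarAlgebra X] {G : Type*} [Group G] [TopologicalSpace G]

/-- `(X, G, α)` is an `F`-dynamical system. -/
structure IsFDynamicalSystem (F : Submodule ℂ (StrongDual ℂ X)) (α : G →* (X ≃⋆ₐ[ℂ] X)) :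
    Prop where
  isDualPair : IsDualPair F
  /-- The involution is `F`-continuous. -/
  continuous_star : Continuous[weakTop F, weakTop F] (fun x : X => star x)
  /-- The multiplication is separately `F`-continuous. -/
  continuous_mul_left : ∀ x : X, Continuous[weakTop F, weakTop F] (fun y : X => x * y)
  continuous_mul_right : ∀ x : X, Continuous[weakTop F, weakTop F] (fun y : X => y * x)
  /-- Each automorphism `α g` is `F`-continuous. -/
  continuous_automorphism : ∀ g : G, Continuous[weakTop F, weakTop F] (fun x : X => α g x)
  /-- Each function `g ↦ φ (α g x)` is continuous. -/
  continuous_orbit : ∀ x : X, ∀ φ ∈ F, Continuous (fun g : G => φ (α g x))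

variable (F : Submodule ℂ (StrongDual ℂ X)) (α : G →* (X ≃⋆ₐ[ℂ] X))

/-- The product `a (1 ⊗ u)` in `X ⊗ Mₙ(ℂ)`. -/
def mulScalarMatrix {n : ℕ} (a : Matrix (Fin n) (Fin n) X) (u : Matrix (Fin n) (Fin n) ℂ) :
    Matrix (Fin n) (Fin n) X :=
  Matrix.of fun i j => ∑ k, u k j • a i k

/-- The product `(1 ⊗ u) a` in `X ⊗ Mₙ(ℂ)`. -/
def scalarMatrixMul {n : ℕ} (u : Matrix (Fin n) (Fin n) ℂ) (a : Matrix (Fin n) (Fin n) X) :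
    Matrix (Fin n) (Fin n) X :=
  Matrix.of fun i j => ∑ k, u i k • a k j

/-- The fixed point set `X^α`. -/
def fixedPoints : Set X := {x | ∀ g, α g x = x}

/-- For an `α`-invariant subalgebra `Y` of `X`, the spectral subspace `Y₂(π)` of `α|_Y`:
all `a ∈ Y ⊗ B(H_π)` with `(α_g ⊗ ι)(a) = a (1 ⊗ π_g)` for all `g`. -/
def spectralSubspace (Y : Set X) (π : UnitaryIrrep G) : Set (Matrix (Fin π.dim) (Fin π.dim) X) :=
  {a | (∀ i j, a i j ∈ Y) ∧ ∀ g, a.map (fun x => α g x) = mulScalarMatrix a (π.mat g)}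

/-- For an `α`-invariant subalgebra `Y` of `X`, the fixed point algebra
`(Y ⊗ B(H_π))^{α ⊗ ad π}`, where `(α_g ⊗ ad π_g)(a) = (1 ⊗ π_g) [α_g(a_ij)] (1 ⊗ π_{g⁻¹})`. -/
def adFixedPoints (Y : Set X) (π : UnitaryIrrep G) : Set (Matrix (Fin π.dim) (Fin π.dim) X) :=
  {a | (∀ i j, a i j ∈ Y) ∧ ∀ g,
    mulScalarMatrix (scalarMatrixMul (π.mat g) (a.map (fun x => α g x))) (π.mat g⁻¹) = a}

/-- The `F`-closure of `Y₂(π)* Y₂(π)`, where a product of two sets stands for the linear span of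
the products of their elements. For `F`-closed `Y` this closure lies in `Y ⊗ B(H_π)`, so that it
makes no difference whether it is taken there or in `X ⊗ B(H_π)`. -/
def spectralIdeal (Y : Set X) (π : UnitaryIrrep G) : Set (Matrix (Fin π.dim) (Fin π.dim) X) :=
  closure[weakMatrixTop F π.dim] (Submodule.span ℂ
    {c | ∃ a ∈ spectralSubspace α Y π, ∃ b ∈ spectralSubspace α Y π, c = a.conjTranspose * b} :
    Set (Matrix (Fin π.dim) (Fin π.dim) X))

/-- A two-sided ideal `I` of `B` is essential when its annihilator in `B` is trivial. -/
def IsEssentialIn {A : Type*} [NonUnitalNonAssocSemiring A] (I B : Set A) : Prop :=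
  ∀ a ∈ B, (∀ b ∈ I, a * b = 0) → a = 0

/-- `sp_F(α|_Y)`, for an `F`-closed `α`-invariant C*-subalgebra `Y` of `X`. -/
def arvesonSpectrum (Y : Set X) : Set (UnitaryDual G) :=
  {π | IsEssentialIn (spectralIdeal F α Y π.rep) (adFixedPoints α Y π.rep)}

/-- Membership in `H_σ^α(X)`: nonzero `α`-invariant `F`-closed hereditary C*-subalgebras of `X`.
(As `G` is a group, `α_g(Y) ⊆ Y` for all `g` means `α_g(Y) = Y` for all `g`.) -/
structure IsInvariantHereditary [PartialOrder X] (Y : NonUnitalStarSubalgebra ℂ X) : Prop where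
  ne_bot : Y ≠ ⊥
  invariant : ∀ g, ∀ y ∈ Y, α g y ∈ Y
  isClosed : IsClosed[weakTop F] (Y : Set X)
  hereditary : ∀ x y : X, y ∈ Y → 0 ≤ x → x ≤ y → x ∈ Y

/-- The Connes spectrum `Γ_F(α)`. -/
def connesSpectrum [PartialOrder X] : Set (UnitaryDual G) :=
  ⋂ (Y : NonUnitalStarSubalgebra ℂ X) (_ : IsInvariantHereditary F α Y),
    arvesonSpectrum F α (Y : Set X)

/-- `J` is a nonzero `F`-closed two-sided ideal of `X^α`. -/
structure IsFixedPointIdeal (J : Submodule ℂ X) : Prop where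
  ne_bot : J ≠ ⊥
  subset : (J : Set X) ⊆ fixedPoints α
  isClosed : IsClosed[weakTop F] (J : Set X)
  mul_mem_left : ∀ x ∈ fixedPoints α, ∀ j ∈ J, x * j ∈ J
  mul_mem_right : ∀ x ∈ fixedPoints α, ∀ j ∈ J, j * x ∈ J

/-- The `F`-closure of `JXJ`, the linear span of all the products `j x k` with `j, k ∈ J` and
`x ∈ X`. -/
def idealCorner (J : Submodule ℂ X) : Set X :=
  closure[weakTop F] (Submodule.span ℂ {z : X | ∃ j ∈ J, ∃ x : X, ∃ k ∈ J, z = j * x * k} : Set X)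

end Dynamics

/-! ### Norm estimates, approximate units and hereditary subalgebras in C*-algebras. -/

section CStarEstimates

open Filter

variable {A : Type*} [NonUnitalCStarAlgebra A] [PartialOrder A] [StarOrderedRing A]

/-! One inclusion holds because each corner $\overline{JXJ}^\sigma$ is itself a nonzero invariant
$\mathcal F$-closed hereditary subalgebra: it absorbs $sXt$ for its own $s,t$, and an approximate
unit turns this into heredity (`isInvariantHereditary_cornerSubalgebra`).

For the other, given $Y$, let $J$ be the $\mathcal F$-closed ideal of $X^\alpha$ generated by
$Y^\alpha=Y\cap X^\alpha$, and suppose $\pi$ lies in the spectrum of its corner. Let $a\in(Y\otimes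
B(H_\pi))^{\alpha\otimes\mathrm{ad}\,\pi}$ annihilate the spectral ideal of $Y$. For $c\in X_2(\pi)$
and $y\in Y^\alpha$, heredity puts $(1\otimes y^*)ca$ in $Y_2(\pi)$, and the C*-identity gives
$a^*c^*(1\otimes y)=0$. The elements $j$ with $a^*c^*(1\otimes j)=0$ for all $c$ form an $\mathcal
F$-closed subspace stable under $X^\alpha$ on both sides, so $J$ lies in it. Hence for $x,y\in
Y^\alpha$ the compression $(1\otimes x)a^*(1\otimes y)$, which has entries in the corner,
annihilates the corner's spectral ideal and vanishes. Finally $a=0$, because $Y^\alpha$ has no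
annihilator in $Y$.

That last fact (`exists_fixedPoint_mul_ne_zero`) is the analytic core. For $u\ne0$ in $Y$, average
$u^*u$ over $G$ by a weak integral, which exists by the compactness axiom of a dual pair. The
product of $u$ with the average is nonzero, as detected by a positive functional in $\mathcal F$.
Such functionals are built as absolute values of norming elements of $\mathcal F$, which stay in
$\mathcal F$ because it is norm closed and stable under $\varphi\mapsto\varphi(\cdot\,a)$. -/

theorem norm_sq_add_smul_mul_le {s d y : A} (hy : ‖y‖ ≤ 1) (t : ℝ) :
    ‖s + t • (y * d)‖ ^ 2 ≤ (1 + t ^ 2) * ‖star s * s + star d * d‖ := by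
  -- A parallelogram-type identity: the added square is chosen to cancel the cross terms.
  have h1 : star (s + t • (y * d)) * (s + t • (y * d))
      + star (t • s - y * d) * (t • s - y * d)
      = (1 + t ^ 2) • (star s * s + star d * (star y * y) * d) := by
    simp only [star_add, star_sub, star_smul, star_mul, add_mul, mul_add, sub_mul, mul_sub,
      smul_mul_assoc, mul_smul_comm, star_trivial, mul_assoc]
    module
  have h2 : star d * (star y * y) * d ≤ star d * d := by
    refine (CStarAlgebra.star_left_conjugate_le_norm_smul (IsSelfAdjoint.star_mul_self y)).trans ?_
    rw [CStarRing.norm_star_mul_self]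
    have : ‖y‖ * ‖y‖ ≤ 1 := by nlinarith [norm_nonneg y]
    calc (‖y‖ * ‖y‖) • (star d * d) ≤ (1 : ℝ) • (star d * d) :=
          smul_le_smul_of_nonneg_right this (star_mul_self_nonneg d)
      _ = _ := one_smul _ _
  have h3 : star (s + t • (y * d)) * (s + t • (y * d))
      ≤ (1 + t ^ 2) • (star s * s + star d * d) :=
    calc _ ≤ star (s + t • (y * d)) * (s + t • (y * d))
          + star (t • s - y * d) * (t • s - y * d) := le_add_of_nonneg_right (star_mul_self_nonneg _)
      _ = _ := h1
      _ ≤ _ := smul_le_smul_of_nonneg_left (by gcongr) (by positivity)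
  have h4 := CStarAlgebra.norm_le_norm_of_nonneg_of_le (star_mul_self_nonneg _) h3
  rw [CStarRing.norm_star_mul_self, norm_smul, Real.norm_of_nonneg (by positivity)] at h4
  rw [sq]; exact h4

theorem norm_sq_add_smul_mul_sub_le {a b y : A} (ha : ‖a‖ ≤ 1) (hb : ‖b‖ ≤ 1) (hy : ‖y‖ ≤ 1)
    (t : ℝ) :
    ‖(1 / 2 : ℝ) • (a + b) + t • (y * ((1 / 2 : ℝ) • (a - b)))‖ ^ 2 ≤ 1 + t ^ 2 := by
  refine (norm_sq_add_smul_mul_le hy t).trans ?_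
  have : star ((1 / 2 : ℝ) • (a + b)) * ((1 / 2 : ℝ) • (a + b))
      + star ((1 / 2 : ℝ) • (a - b)) * ((1 / 2 : ℝ) • (a - b))
      = (1 / 2 : ℝ) • (star a * a) + (1 / 2 : ℝ) • (star b * b) := by
    simp only [star_add, star_sub, star_smul, add_mul, mul_add, sub_mul, mul_sub,
      smul_mul_assoc, mul_smul_comm, star_trivial]
    module
  rw [this]
  have h1 : ‖(1 / 2 : ℝ) • (star a * a) + (1 / 2 : ℝ) • (star b * b)‖ ≤ 1 := by
    refine (norm_add_le _ _).trans ?_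
    rw [norm_smul, norm_smul, CStarRing.norm_star_mul_self, CStarRing.norm_star_mul_self]
    norm_num
    nlinarith [norm_nonneg a, norm_nonneg b]
  nlinarith [sq_nonneg t]

/-- In the expansion of the square the cross term is $2\,\mathrm{Re}(c)\,a^*ya\le0$ and can be
dropped, so the bound has no term linear in $c$. -/
theorem norm_sq_add_smul_nonneg_mul_le {a y : A} (ha : ‖a‖ ≤ 1) (hy : 0 ≤ y) {c : ℂ}
    (hc : c.re ≤ 0) : ‖a + c • (y * a)‖ ^ 2 ≤ 1 + ‖c‖ ^ 2 * ‖y‖ ^ 2 := by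
  have hy' : star y = y := (IsSelfAdjoint.of_nonneg hy).star_eq
  have h1 : star (a + c • (y * a)) * (a + c • (y * a))
      = star a * a + (‖c‖ ^ 2) • (star (y * a) * (y * a)) + (2 * c.re) • (star a * y * a) := by
    have hcc : star c * c = ((‖c‖ ^ 2 : ℝ) : ℂ) := by
      rw [Complex.star_def, Complex.conj_mul']; norm_cast
    have hcr : star c + c = ((2 * c.re : ℝ) : ℂ) := by
      rw [Complex.star_def, add_comm, Complex.add_conj]
    rw [← Complex.coe_smul (‖c‖ ^ 2), ← Complex.coe_smul (2 * c.re), ← hcc, ← hcr]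
    simp only [star_add, star_smul, star_mul, add_mul, mul_add, hy',
      smul_mul_assoc, mul_smul_comm, mul_assoc]
    module
  have h2 : (2 * c.re) • (star a * y * a) ≤ 0 :=
    smul_nonpos_of_nonpos_of_nonneg (by linarith) (star_left_conjugate_nonneg hy a)
  have h3 : star (a + c • (y * a)) * (a + c • (y * a))
      ≤ star a * a + (‖c‖ ^ 2) • (star (y * a) * (y * a)) := by
    rw [h1]; exact add_le_of_nonpos_right h2
  have h4 := CStarAlgebra.norm_le_norm_of_nonneg_of_le (star_mul_self_nonneg _) h3
  rw [CStarRing.norm_star_mul_self, ← sq] at h4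
  refine h4.trans ((norm_add_le _ _).trans ?_)
  rw [norm_smul, CStarRing.norm_star_mul_self, CStarRing.norm_star_mul_self,
    Real.norm_of_nonneg (by positivity)]
  have h5 : ‖y * a‖ ≤ ‖y‖ := (norm_mul_le _ _).trans (mul_le_of_le_one_right (norm_nonneg _) ha)
  have h6 : ‖y * a‖ * ‖y * a‖ ≤ ‖y‖ ^ 2 := by rw [← sq]; gcongr
  have h7 : ‖a‖ * ‖a‖ ≤ 1 := by nlinarith [norm_nonneg a]
  gcongr

theorem norm_two_smul_sub_sq_le {z : A} (hz : 0 ≤ z) (hz1 : ‖z‖ ≤ 1) :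
    ‖(2 : ℝ) • z - z * z‖ ≤ 1 := by
  have hsa : IsSelfAdjoint z := .of_nonneg hz
  have h1 : cfcₙ (fun x : ℝ => 2 * x - x * x) z = (2 : ℝ) • z - z * z := by
    rw [cfcₙ_sub (fun x : ℝ => 2 * x) (fun x => x * x) z,
      cfcₙ_const_mul (2 : ℝ) (fun x => x) z, cfcₙ_mul (fun x : ℝ => x) (fun x => x) z,
      cfcₙ_id' ℝ z]
  rw [← h1]
  refine norm_cfcₙ_le fun x hx => ?_
  have hx0 : 0 ≤ x := quasispectrum_nonneg_of_nonneg z hz x hx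
  have hx1 : x ≤ 1 := by
    have := norm_apply_le_norm_cfcₙ (fun x : ℝ => x) z hx
    rw [cfcₙ_id' ℝ z, Real.norm_of_nonneg hx0] at this
    exact this.trans hz1
  rw [Real.norm_eq_abs, abs_le]
  constructor <;> nlinarith

/-- This is monotonicity of $x\mapsto(1-e)x(1-e)$, written without a unit. -/
theorem sub_conjugate_mono {x y e : A} (he : star e = e) (hxy : x ≤ y) :
    x - e * x - x * e + e * x * e ≤ y - e * y - y * e + e * y * e := by
  obtain ⟨w, hw⟩ := CStarAlgebra.nonneg_iff_eq_mul_star_self.1 (sub_nonneg.2 hxy)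
  have h : (y - e * y - y * e + e * y * e) - (x - e * x - x * e + e * x * e)
      = (w - e * w) * star (w - e * w) := by
    calc _ = (y - x) - e * (y - x) - (y - x) * e + e * (y - x) * e := by
          simp only [mul_sub, sub_mul]; abel
      _ = _ := by
          rw [hw]
          simp only [star_sub, star_mul, he, mul_sub, sub_mul, mul_assoc]; abel
  rw [← sub_nonneg, h]
  exact mul_star_self_nonneg _

/-- A positive element `y` has an approximate unit, lying in every closed star subalgebra that
contains `y`, for all elements `r` with `r * star r ≤ y`. -/
theorem exists_approximate_unit_of_nonneg {y : A} (hy : 0 ≤ y) :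
    ∃ e : ℕ → A, (∀ n, star (e n) = e n) ∧
      (∀ S : NonUnitalStarSubalgebra ℂ A, IsClosed (S : Set A) → y ∈ S → ∀ n, e n ∈ S) ∧
      ∀ r : A, r * star r ≤ y → Tendsto (fun n => e n * r) atTop (𝓝 r) := by
  have hsa : IsSelfAdjoint y := .of_nonneg hy
  have hspec : ∀ x ∈ quasispectrum ℝ y, 0 ≤ x := quasispectrum_nonneg_of_nonneg y hy
  -- The absolute value only serves continuity on all of $\mathbb R$. On the spectrum,
  -- $(1-f_n(x))^2x=x/(1+nx)^2\le1/n$.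
  let f : ℕ → ℝ → ℝ := fun n x => (n * x) / (1 + n * |x|)
  have hden : ∀ (n : ℕ) (x : ℝ), (1 + n * |x|) ≠ 0 := fun n x => by positivity
  have hf : ∀ n, Continuous (f n) := fun n =>
    Continuous.div (by fun_prop) (by fun_prop) (hden n)
  have hf0 : ∀ n, f n 0 = 0 := fun n => by simp [f]
  have hsae : ∀ n, star (cfcₙ (f n) y) = cfcₙ (f n) y := fun n => (cfcₙ_predicate (f n) y).star_eq
  refine ⟨fun n => cfcₙ (f n) y, hsae, ?_, ?_⟩
  · intro S hS hyS n
    have : IsClosed (S : Set A) := hS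
    exact cfcₙ_mem (𝕜' := ℂ) (f n) hyS
  · intro r hr
    have key : ∀ n : ℕ, 0 < n → ‖cfcₙ (f n) y * r - r‖ ^ 2 ≤ 1 / n := by
      intro n hn
      set e := cfcₙ (f n) y with he
      have hse : star e = e := hsae n
      have h1 : (r - e * r) * star (r - e * r)
          = r * star r - e * (r * star r) - r * star r * e + e * (r * star r) * e := by
        simp only [star_sub, star_mul, hse, mul_sub, sub_mul, mul_assoc]; abel
      have h2 : y - e * y - y * e + e * y * e
          = cfcₙ (fun x : ℝ => x - f n x * x - x * f n x + f n x * x * f n x) y := by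
        have hc : ∀ g : ℝ → ℝ, Continuous g → ContinuousOn g (quasispectrum ℝ y) :=
          fun g hg => hg.continuousOn
        have hfn := hf n
        rw [cfcₙ_add (fun x : ℝ => x - f n x * x - x * f n x) (fun x => f n x * x * f n x) y
            (hc _ (by fun_prop)) (by simp [hf0]) (hc _ (by fun_prop)) (by simp [hf0]),
          cfcₙ_sub (fun x : ℝ => x - f n x * x) (fun x => x * f n x) y
            (hc _ (by fun_prop)) (by simp [hf0]) (hc _ (by fun_prop)) (by simp [hf0]),
          cfcₙ_sub (fun x : ℝ => x) (fun x => f n x * x) y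
            (hc _ (by fun_prop)) (by simp) (hc _ (by fun_prop)) (by simp [hf0]),
          cfcₙ_mul (fun x => f n x * x) (f n) y
            (hc _ (by fun_prop)) (by simp [hf0]) (hc _ (by fun_prop)) (by simp [hf0]),
          cfcₙ_mul (f n) (fun x => x) y
            (hc _ (by fun_prop)) (by simp [hf0]) (hc _ (by fun_prop)) (by simp),
          cfcₙ_mul (fun x => x) (f n) y
            (hc _ (by fun_prop)) (by simp) (hc _ (by fun_prop)) (by simp [hf0]),
          cfcₙ_id' ℝ y]
      have h3 : ‖y - e * y - y * e + e * y * e‖ ≤ 1 / n := by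
        rw [h2]
        refine norm_cfcₙ_le fun x hx => ?_
        have hx0 := hspec x hx
        have hn' : (0 : ℝ) < n := by exact_mod_cast hn
        have hp : (0 : ℝ) < 1 + n * x := by positivity
        have : x - f n x * x - x * f n x + f n x * x * f n x = x / (1 + n * x) ^ 2 := by
          simp only [f, abs_of_nonneg hx0]
          field_simp
          ring
        rw [this, Real.norm_of_nonneg (by positivity), div_le_div_iff₀ (by positivity) hn']
        nlinarith [mul_nonneg hn'.le hx0]
      have h4 : ‖(r - e * r) * star (r - e * r)‖ ≤ 1 / n := by
        refine (CStarAlgebra.norm_le_norm_of_nonneg_of_le (mul_star_self_nonneg _) ?_).trans h3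
        rw [h1]
        exact sub_conjugate_mono hse hr
      rw [CStarRing.norm_self_mul_star, ← sq, norm_sub_rev] at h4
      exact h4
    rw [tendsto_iff_norm_sub_tendsto_zero]
    have h5 : Tendsto (fun n : ℕ => ‖cfcₙ (f n) y * r - r‖ ^ 2) atTop (𝓝 0) := by
      refine squeeze_zero' (Eventually.of_forall fun n => by positivity) ?_
        tendsto_one_div_atTop_nhds_zero_nat
      filter_upwards [eventually_gt_atTop 0] with n hn using key n hn
    have h6 := h5.sqrt
    simpa [Real.sqrt_sq (norm_nonneg _)] using h6

/-- Write $x=rr^*\le y$. The approximate unit of $y$ lies in $S$, so $e_nxe_n\in SAS\subseteq S$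
converges to $x$. -/
theorem NonUnitalStarSubalgebra.mem_of_nonneg_of_le {S : NonUnitalStarSubalgebra ℂ A}
    (hS : IsClosed (S : Set A)) (hcorner : ∀ s ∈ S, ∀ t ∈ S, ∀ w : A, s * w * t ∈ S) {x y : A}
    (hy : y ∈ S) (hx : 0 ≤ x) (hxy : x ≤ y) : x ∈ S := by
  obtain ⟨e, he, heS, hlim⟩ := exists_approximate_unit_of_nonneg (hx.trans hxy)
  obtain ⟨r, rfl⟩ := CStarAlgebra.nonneg_iff_eq_mul_star_self.1 hx
  have h1 := (hlim r hxy).mul (hlim r hxy).star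
  refine hS.mem_of_tendsto h1 (Eventually.of_forall fun n => ?_)
  have h2 : e n * r * star (e n * r) = e n * (r * star r) * e n := by
    simp only [star_mul, he, mul_assoc]
  show e n * r * star (e n * r) ∈ (S : Set A)
  rw [h2]
  exact hcorner _ (heS S hS hy n) _ (heS S hS hy n) _

/-- For $w\ge0$, heredity applies to $s^*ws\le\|w\|s^*s$. Polarization then separates the two outer
factors, and positive elements span the algebra. -/
theorem NonUnitalStarSubalgebra.mul_mul_mem_of_hereditary {S : NonUnitalStarSubalgebra ℂ A}
    (hS : ∀ x y : A, y ∈ S → 0 ≤ x → x ≤ y → x ∈ S) {s t : A} (hs : s ∈ S) (ht : t ∈ S) (w : A) :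
    s * w * t ∈ S := by
  have hpos : ∀ w : A, 0 ≤ w → ∀ s ∈ S, star s * w * s ∈ S := by
    intro w hw s hs
    refine hS _ (‖w‖ • (star s * s)) ?_ (star_left_conjugate_nonneg hw s)
      (CStarAlgebra.star_left_conjugate_le_norm_smul (.of_nonneg hw))
    rw [← Complex.coe_smul]
    exact SMulMemClass.smul_mem _ (mul_mem (star_mem hs) hs)
  have hpol : ∀ w : A, 0 ≤ w → s * w * t ∈ S := by
    intro w hw
    have hI : ∀ c : ℂ, star (star s + c • t) * w * (star s + c • t) ∈ S := fun c =>
      hpos w hw _ (add_mem (star_mem hs) (SMulMemClass.smul_mem c ht))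
    have h : s * w * t = (1 / 4 : ℂ) • (star (star s + (1 : ℂ) • t) * w * (star s + (1 : ℂ) • t)
        - star (star s + (-1 : ℂ) • t) * w * (star s + (-1 : ℂ) • t)
        + (-Complex.I) • (star (star s + Complex.I • t) * w * (star s + Complex.I • t))
        - (-Complex.I) • (star (star s + (-Complex.I) • t) * w * (star s + (-Complex.I) • t))) := by
      have hII := Complex.I_mul_I
      simp only [star_add, star_smul, star_star, add_mul, mul_add, smul_mul_assoc, mul_smul_comm,
        Complex.star_def, map_neg, Complex.conj_I, map_one, smul_add, smul_smul, neg_mul, mul_neg,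
        hII, neg_neg]
      module
    rw [h]
    exact SMulMemClass.smul_mem _ (sub_mem (add_mem (sub_mem (hI _) (hI _))
      (SMulMemClass.smul_mem _ (hI _))) (SMulMemClass.smul_mem _ (hI _)))
  have hw : w ∈ Submodule.span ℂ {a : A | 0 ≤ a} := by rw [CStarAlgebra.span_nonneg]; trivial
  induction hw using Submodule.span_induction with
  | mem w hw => exact hpol w hw
  | zero => simp
  | add v w _ _ hv hw => rw [mul_add, add_mul]; exact add_mem hv hw
  | smul c w _ hw => rw [mul_smul_comm, smul_mul_assoc]; exact SMulMemClass.smul_mem c hw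

end CStarEstimates

/-! ### The $\mathcal F$-topology and its dual. -/

section WeakTopology

variable {X : Type*} [NormedAddCommGroup X] [NormedSpace ℂ X] {F : Submodule ℂ (StrongDual ℂ X)}

theorem continuous_weakTop_apply {φ : StrongDual ℂ X} (hφ : φ ∈ F) :
    Continuous[weakTop F, inferInstance] (fun x : X => φ x) := by
  have h : Continuous fun v : F → ℂ => v ⟨φ, hφ⟩ := continuous_apply _
  exact @Continuous.comp X (F → ℂ) ℂ (weakTop F) _ _ (fun x φ => (φ : StrongDual ℂ X) x) _ h
    continuous_induced_dom

theorem continuous_weakTop_apply_comp {φ : StrongDual ℂ X} (hφ : φ ∈ F) {f : X → X}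
    (hf : Continuous[weakTop F, weakTop F] f) :
    Continuous[weakTop F, inferInstance] (fun x : X => φ (f x)) :=
  @Continuous.comp X X ℂ (weakTop F) (weakTop F) _ f _ (continuous_weakTop_apply hφ) hf

theorem norm_le_weakTop : (inferInstance : TopologicalSpace X) ≤ weakTop F :=
  continuous_iff_le_induced.1 (continuous_pi fun φ : F => (φ : StrongDual ℂ X).continuous)

theorem isClosed_of_isClosed_weakTop {S : Set X} (hS : IsClosed[weakTop F] S) : IsClosed S :=
  IsClosed.mono hS norm_le_weakTop

/-- The dual of $(X,\sigma(X,\mathcal F))$ is exactly $\mathcal F$. This converts $\mathcal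
F$-continuity of a map into stability of $\mathcal F$ under composition with it. -/
theorem exists_mem_eq_of_continuous_weakTop (f : X →ₗ[ℂ] ℂ)
    (hf : Continuous[weakTop F, inferInstance] f) : ∃ φ ∈ F, ∀ x, φ x = f x := by
  have h : f ∈ Submodule.span ℂ
      (Set.range fun φ : F => ((φ : StrongDual ℂ X) : X →ₗ[ℂ] ℂ)) := by
    rw [LinearMap.mem_span_iff_continuous]
    convert hf using 1
    rw [weakTop, induced_to_pi]
    rfl
  have hr : (Set.range fun φ : F => ((φ : StrongDual ℂ X) : X →ₗ[ℂ] ℂ))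
      = (F.map (ContinuousLinearMap.coeLM ℂ : StrongDual ℂ X →ₗ[ℂ] X →ₗ[ℂ] ℂ) :
        Set (X →ₗ[ℂ] ℂ)) := by
    ext g
    simp
  rw [hr, Submodule.span_eq] at h
  obtain ⟨φ, hφ, rfl⟩ := h
  exact ⟨φ, hφ, fun x => rfl⟩

theorem IsDualPair.eq_zero_of_forall (hF : IsDualPair F) {x : X} (h : ∀ φ ∈ F, φ x = 0) :
    x = 0 := by
  have h1 : ‖x‖ ≤ 0 := (hF.norm_eq_left x).2 (by
    rintro r ⟨φ, hφ, -, rfl⟩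
    simp [h φ hφ])
  exact norm_le_zero_iff.1 h1

theorem continuous_weakTop_rng {Y : Type*} [TopologicalSpace Y] {f : Y → X} :
    Continuous[inferInstance, weakTop F] f ↔ ∀ φ ∈ F, Continuous fun y => φ (f y) := by
  rw [continuous_induced_rng, continuous_pi_iff]
  exact ⟨fun h φ hφ => h ⟨φ, hφ⟩, fun h φ => h φ φ.2⟩

end WeakTopology

/-! ### Positive functionals in $\mathcal F$. -/

section PositiveFunctionals

open Filter

variable {X : Type*} [NonUnitalCStarAlgebra X] [PartialOrder X] [StarOrderedRing X]
  {F : Submodule ℂ (StrongDual ℂ X)}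

/-- Two points at which $\varphi$ almost attains its norm give almost the same functional
$\varphi(\cdot\,a)$. Perturbing their midpoint by $\tau y(a-b)/2$ raises the norm only to second
order in $\tau$, so the first-order gain $\tau\,\mathrm{Re}\,\varphi(y(a-b))/2$ is at most
$3\tau^2/2$. -/
theorem norm_apply_mul_sub_le {φ : StrongDual ℂ X} (hφ : ‖φ‖ ≤ 1) {a b : X} (ha : ‖a‖ ≤ 1)
    (hb : ‖b‖ ≤ 1) {τ : ℝ} (hτ : 0 < τ) (ha' : 1 - τ ^ 2 ≤ (φ a).re) (hb' : 1 - τ ^ 2 ≤ (φ b).re)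
    (y : X) : ‖φ (y * (a - b))‖ ≤ 3 * τ * ‖y‖ := by
  have hre : ∀ y : X, ‖y‖ ≤ 1 → (φ (y * (a - b))).re ≤ 3 * τ := by
    intro y hy
    have h1 := norm_sq_add_smul_mul_sub_le ha hb hy τ
    set v := (1 / 2 : ℝ) • (a + b) + τ • (y * ((1 / 2 : ℝ) • (a - b))) with hv
    have h2 : (φ v).re ≤ ‖v‖ := (Complex.re_le_norm _).trans
      ((φ.le_opNorm v).trans (mul_le_of_le_one_left (norm_nonneg _) hφ))
    have h3 : φ v = ((1 / 2 : ℝ) : ℂ) * (φ a + φ b)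
        + (τ : ℂ) * (((1 / 2 : ℝ) : ℂ) * φ (y * (a - b))) := by
      simp only [hv, mul_smul_comm, ← Complex.coe_smul, map_add, map_smul, smul_eq_mul]
    have h4 : (φ v).re = 1 / 2 * ((φ a).re + (φ b).re) + τ * (1 / 2 * (φ (y * (a - b))).re) := by
      rw [h3, Complex.add_re, Complex.re_ofReal_mul, Complex.re_ofReal_mul, Complex.re_ofReal_mul,
        Complex.add_re]
    have h5 : ‖v‖ ≤ 1 + τ ^ 2 / 2 := by
      refine le_of_sq_le_sq ?_ (by positivity)
      nlinarith [sq_nonneg (τ ^ 2)]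
    nlinarith
  have hunit : ∀ y : X, ‖y‖ ≤ 1 → ‖φ (y * (a - b))‖ ≤ 3 * τ := by
    intro y hy
    obtain ⟨c, hc, hc'⟩ := Complex.exists_norm_eq_mul_self (φ (y * (a - b)))
    have h := hre (c • y) (by rw [norm_smul, hc, one_mul]; exact hy)
    rw [smul_mul_assoc, map_smul, smul_eq_mul, ← hc'] at h
    simpa using h
  rcases eq_or_ne y 0 with rfl | hy
  · simp
  · have hn : 0 < ‖y‖ := norm_pos_iff.2 hy
    have h := hunit ((‖y‖⁻¹ : ℝ) • y) (by
      rw [norm_smul, norm_inv, norm_norm, inv_mul_cancel₀ hn.ne'])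
    rw [smul_mul_assoc, ← Complex.coe_smul, map_smul, norm_smul, Complex.norm_real, norm_inv,
      norm_norm, inv_mul_le_iff₀ hn] at h
    linarith

theorem tendsto_one_of_re_of_norm_le {u : ℕ → ℂ} (hu : ∀ n, ‖u n‖ ≤ 1)
    (hre : Tendsto (fun n => (u n).re) atTop (𝓝 1)) : Tendsto u atTop (𝓝 1) := by
  rw [tendsto_iff_norm_sub_tendsto_zero]
  have h1 : Tendsto (fun n => 2 * (1 - (u n).re)) atTop (𝓝 0) := by
    have := (tendsto_const_nhds (x := (1 : ℝ))).sub hre |>.const_mul 2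
    simpa using this
  have h2 : Tendsto (fun n => ‖u n - 1‖ ^ 2) atTop (𝓝 0) := by
    refine squeeze_zero (fun n => by positivity) (fun n => ?_) h1
    have h3 : ‖u n‖ ^ 2 ≤ 1 := by have := hu n; nlinarith [norm_nonneg (u n)]
    rw [← Complex.normSq_eq_norm_sq, Complex.normSq_apply] at h3 ⊢
    simp only [Complex.sub_re, Complex.sub_im, Complex.one_re, Complex.one_im]
    nlinarith
  have h6 := h2.sqrt
  simpa [Real.sqrt_sq (norm_nonneg _)] using h6

/-- The absolute value of a functional of norm one: a norm limit `ψ` of functionals `φ (· * a)`,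
where `a` runs through a sequence in the unit ball along which `φ` attains its norm. -/
theorem exists_nonneg_functional {φ : StrongDual ℂ X} (hφ : ‖φ‖ = 1) 
    (hF : IsClosed (F : Set (StrongDual ℂ X)))
    (hmul : ∀ a : X, φ.comp ((ContinuousLinearMap.mul ℂ X).flip a) ∈ F) :
    ∃ ψ ∈ F, (∀ y, 0 ≤ y → 0 ≤ (ψ y).re ∧ (ψ y).im = 0) ∧
      ∀ τ : ℝ, 0 < τ → ∀ z : X, ‖z‖ ≤ 1 → 1 - τ ^ 2 ≤ (φ z).re →
        ∀ y, ‖ψ y - φ (y * z)‖ ≤ 3 * τ * ‖y‖ := by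
  have hex : ∀ τ : ℝ, 0 < τ → ∃ a : X, ‖a‖ ≤ 1 ∧ 1 - τ ^ 2 ≤ (φ a).re := by
    intro τ hτ
    have hτ2 : 1 - τ ^ 2 < ‖φ‖ := by rw [hφ]; nlinarith [sq_pos_of_pos hτ]
    obtain ⟨x, hx, hx'⟩ := φ.exists_lt_apply_of_lt_opNorm hτ2
    obtain ⟨c, hc, hc'⟩ := Complex.exists_norm_eq_mul_self (φ x)
    refine ⟨c • x, by rw [norm_smul, hc, one_mul]; exact hx.le, ?_⟩
    rw [map_smul, smul_eq_mul, ← hc']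
    simpa using hx'.le
  let τ : ℕ → ℝ := fun n => 1 / ((n : ℝ) + 1)
  have hτ : ∀ n, 0 < τ n := fun n => by positivity
  have hτ0 : Tendsto τ atTop (𝓝 0) := tendsto_one_div_add_atTop_nhds_zero_nat
  choose a ha ha' using fun n => hex (τ n) (hτ n)
  let Ψ : ℕ → StrongDual ℂ X := fun n => φ.comp ((ContinuousLinearMap.mul ℂ X).flip (a n))
  have hΨ : ∀ n y, Ψ n y = φ (y * a n) := fun n y => rfl
  have hcauchy : CauchySeq Ψ := by
    refine cauchySeq_of_le_tendsto_0 (fun n => 3 * τ n) (fun n m N hn hm => ?_)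
      (by simpa using hτ0.const_mul 3)
    have hanti : ∀ k, N ≤ k → 1 - τ N ^ 2 ≤ (φ (a k)).re := by
      intro k hk
      have h1 : τ k ≤ τ N := by
        apply one_div_le_one_div_of_le (by positivity)
        have : (N : ℝ) ≤ k := by exact_mod_cast hk
        linarith
      have := ha' k
      have h2 := (hτ k).le
      nlinarith
    rw [dist_eq_norm]
    refine ContinuousLinearMap.opNorm_le_bound _ (by have := (hτ N).le; positivity) fun y => ?_
    rw [sub_apply, hΨ, hΨ, ← map_sub, ← mul_sub]
    exact norm_apply_mul_sub_le hφ.le (ha n) (ha m) (hτ N) (hanti n hn) (hanti m hm) y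
  obtain ⟨ψ, hψ⟩ := cauchySeq_tendsto_of_complete hcauchy
  have hψy : ∀ y, Tendsto (fun n => φ (y * a n)) atTop (𝓝 (ψ y)) := fun y =>
    ((ContinuousLinearMap.apply ℂ ℂ y).continuous.tendsto ψ).comp hψ
  have hφa : Tendsto (fun n => φ (a n)) atTop (𝓝 1) := by
    refine tendsto_one_of_re_of_norm_le (fun n => ?_) ?_
    · exact (φ.le_opNorm _).trans (by rw [hφ, one_mul]; exact ha n)
    · refine tendsto_of_tendsto_of_tendsto_of_le_of_le (g := fun n => 1 - τ n ^ 2)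
        (h := fun _ => 1) ?_ tendsto_const_nhds ha' fun n => ?_
      · simpa using (tendsto_const_nhds (x := (1 : ℝ))).sub (hτ0.pow 2)
      · exact (Complex.re_le_norm _).trans ((φ.le_opNorm _).trans (by
          rw [hφ, one_mul]; exact ha n))
  refine ⟨ψ, hF.mem_of_tendsto hψ (Eventually.of_forall fun n => hmul (a n)), ?_, ?_⟩
  · intro y hy
    -- Limit of the bound on $\|a_n+c\,ya_n\|^2$, using $\varphi(a_n)\to1$.
    have h1 : ∀ c : ℂ, c.re ≤ 0 → ‖1 + c * ψ y‖ ^ 2 ≤ 1 + ‖c‖ ^ 2 * ‖y‖ ^ 2 := by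
      intro c hc
      have hlim : Tendsto (fun n => ‖φ (a n) + c * φ (y * a n)‖ ^ 2) atTop
          (𝓝 (‖1 + c * ψ y‖ ^ 2)) := ((hφa.add ((hψy y).const_mul c)).norm).pow 2
      refine le_of_tendsto hlim (Eventually.of_forall fun n => ?_)
      have h2 : φ (a n) + c * φ (y * a n) = φ (a n + c • (y * a n)) := by simp
      rw [h2]
      refine le_trans ?_ (norm_sq_add_smul_nonneg_mul_le (ha n) hy hc)
      gcongr
      exact (φ.le_opNorm _).trans (by rw [hφ, one_mul])
    have h2 : ∀ c : ℂ, c.re ≤ 0 → (c * ψ y).re ≤ 0 := by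
      intro c hc
      by_contra! hpos
      set K := ‖c‖ ^ 2 * ‖y‖ ^ 2 with hK
      have hK0 : 0 ≤ K := by positivity
      set p := (c * ψ y).re with hp
      -- Replacing $c$ by $\varepsilon c$ leaves a linear term on the left against a quadratic one
      -- on the right.
      have h3 : ∀ ε : ℝ, 0 < ε → 2 * p ≤ ε * K := by
        intro ε hε
        have h4 := h1 (ε * c) (by rw [Complex.re_ofReal_mul]; nlinarith)
        have h5 : (1 + ε * p) ^ 2 ≤ ‖1 + ε * c * ψ y‖ ^ 2 := by
          have h6 : (1 + ε * c * ψ y).re = 1 + ε * p := by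
            rw [mul_assoc, Complex.add_re, Complex.re_ofReal_mul, Complex.one_re]
          rw [← h6, ← Complex.normSq_eq_norm_sq, Complex.normSq_apply]
          nlinarith [sq_nonneg (1 + ε * c * ψ y).im]
        rw [norm_mul, Complex.norm_real, Real.norm_of_nonneg hε.le, mul_pow, 
          mul_assoc (ε ^ 2), ← hK] at h4
        have h7 : ε * (2 * p) ≤ ε * (ε * K) := by nlinarith [sq_nonneg (ε * p)]
        exact le_of_mul_le_mul_left h7 hε
      have h8 := h3 (p / (K + 1)) (by positivity)
      have h9 : p / (K + 1) * K ≤ p := by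
        rw [div_mul_eq_mul_div, div_le_iff₀ (by positivity)]
        nlinarith
      linarith
    -- The choice $c=-1$ gives a nonnegative real part, and $c=\pm i$ kills the imaginary part.
    have e1 := h2 (-1) (by simp)
    have e2 := h2 Complex.I (by simp)
    have e3 := h2 (-Complex.I) (by simp)
    simp at e1 e2 e3
    exact ⟨e1, le_antisymm e3 e2⟩
  · intro σ hσ z hz hz' y
    have hlim : Tendsto (fun n => ‖φ (y * a n) - φ (y * z)‖) atTop (𝓝 ‖ψ y - φ (y * z)‖) :=
      ((hψy y).sub_const _).norm
    refine le_of_tendsto hlim ?_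
    filter_upwards [hτ0.eventually_lt_const hσ] with n hn
    rw [← map_sub, ← mul_sub]
    refine norm_apply_mul_sub_le hφ.le (ha n) hz hσ ?_ hz' y
    have := ha' n
    have h2 := (hτ n).le
    nlinarith

/-- Let $\|z\|=1$ and let $\varphi$ nearly attain its norm at $z$, with absolute value $\psi$. If
$\mathrm{Re}\,\psi(z)=0$, then $\mathrm{Re}\,\varphi(z^2)$ is small, so
$\mathrm{Re}\,\varphi(2z-z^2)$ is close to $2$, against $\|2z-z^2\|\le1$. -/
theorem exists_nonneg_functional_apply_ne_zero (hF : IsDualPair F)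
    (hmul : ∀ φ ∈ F, ∀ a : X, φ.comp ((ContinuousLinearMap.mul ℂ X).flip a) ∈ F) {z : X}
    (hz : 0 ≤ z) (hz0 : z ≠ 0) :
    ∃ ψ ∈ F, (∀ y, 0 ≤ y → 0 ≤ (ψ y).re ∧ (ψ y).im = 0) ∧ (ψ z).re ≠ 0 := by
  wlog hz1 : ‖z‖ = 1 generalizing z
  · have hn : 0 < ‖z‖ := norm_pos_iff.2 hz0
    obtain ⟨ψ, hψ, hpos, hne⟩ := this (z := (‖z‖⁻¹ : ℝ) • z) (smul_nonneg (by positivity) hz)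
      (smul_ne_zero (by positivity) hz0)
      (by rw [norm_smul, norm_inv, norm_norm, inv_mul_cancel₀ hn.ne'])
    refine ⟨ψ, hψ, hpos, fun h => hne ?_⟩
    rw [← Complex.coe_smul, map_smul, smul_eq_mul, Complex.re_ofReal_mul, h, mul_zero]
  -- The value $\tau=1/10$ is small enough: $2(1-\tau^2)-3\tau=1.68>1$.
  obtain ⟨r, ⟨φ₀, hφ₀, hφ₀1, rfl⟩, hr⟩ :
      ∃ r ∈ {r : ℝ | ∃ φ ∈ F, ‖φ‖ ≤ 1 ∧ r = ‖φ z‖}, 1 - (1 / 10) ^ 2 < r := by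
    refine (lt_isLUB_iff (hF.norm_eq_left z)).1 ?_
    rw [hz1]; norm_num
  obtain ⟨c, hc, hc'⟩ := Complex.exists_norm_eq_mul_self (φ₀ z)
  have hφ₀0 : 0 < ‖φ₀‖ := by
    refine norm_pos_iff.2 ?_
    rintro rfl
    norm_num at hr
  set φ : StrongDual ℂ X := ((‖φ₀‖⁻¹ : ℝ) * c : ℂ) • φ₀ with hφ
  have hφF : φ ∈ F := F.smul_mem _ hφ₀
  have hφ1 : ‖φ‖ = 1 := by
    rw [hφ, norm_smul, norm_mul, hc, mul_one, Complex.norm_real, norm_inv, norm_norm,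
      inv_mul_cancel₀ hφ₀0.ne']
  have hφz : 1 - (1 / 10) ^ 2 ≤ (φ z).re := by
    have h1 : φ z = ((‖φ₀‖⁻¹ * ‖φ₀ z‖ : ℝ) : ℂ) := by
      rw [hφ, smul_apply, smul_eq_mul, mul_assoc, ← hc']; push_cast; rfl
    rw [h1, Complex.ofReal_re]
    refine hr.le.trans (le_mul_of_one_le_left (norm_nonneg _) ?_)
    exact (one_le_inv₀ hφ₀0).2 hφ₀1
  obtain ⟨ψ, hψ, hpos, happrox⟩ := exists_nonneg_functional hφ1 hF.isClosed (hmul φ hφF)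
  refine ⟨ψ, hψ, hpos, fun h0 => ?_⟩
  have h1 := happrox (1 / 10) (by norm_num) z hz1.le hφz z
  rw [hz1] at h1
  have h2 : (φ ((2 : ℝ) • z - z * z)).re ≤ 1 := (Complex.re_le_norm _).trans
    ((φ.le_opNorm _).trans (by rw [hφ1, one_mul]; exact norm_two_smul_sub_sq_le hz hz1.le))
  rw [map_sub, ← Complex.coe_smul, map_smul, smul_eq_mul, Complex.sub_re,
    Complex.re_ofReal_mul] at h2
  have h3 := (Complex.abs_re_le_norm _).trans h1
  rw [Complex.sub_re, h0, abs_le] at h3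
  linarith [h3.1]

end PositiveFunctionals

/-! ### Weak integrals over compact spaces. -/

section WeakIntegral

open MeasureTheory

/-- The weak integral of an `F`-continuous function on a compact space exists, by the compactness
of the `F`-closed convex hull of its range. -/
theorem IsDualPair.exists_weak_integral {X : Type*} [NormedAddCommGroup X] [NormedSpace ℂ X]
    {F : Submodule ℂ (StrongDual ℂ X)} (hF : IsDualPair F) {K : Type*} [TopologicalSpace K]
    [CompactSpace K] [MeasurableSpace K] [BorelSpace K] (μ : Measure K) [IsProbabilityMeasure μ]
    {f : K → X} (hf : ∀ φ ∈ F, Continuous fun k => φ (f k)) :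
    ∃ p : X, (∀ φ ∈ F, φ p = ∫ k, φ (f k) ∂μ) ∧
      ∀ S : Set X, IsClosed[weakTop F] S → Convex ℝ S → (∀ k, f k ∈ S) → p ∈ S := by
  let ev : X → F → ℂ := fun x φ => (φ : StrongDual ℂ X) x
  have hR1 : @R1Space X (weakTop F) := R1Space.induced ev
  have hrange : @IsCompact X (weakTop F) (Set.range f) :=
    @isCompact_range _ _ _ (weakTop F) _ _ (continuous_weakTop_rng.2 hf)
  have hcl : @IsCompact X (weakTop F) (closure[weakTop F] (Set.range f)) :=
    @IsCompact.closure _ (weakTop F) hR1 _ hrange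
  have hC := hF.convexHull_left _ hcl
  set C : Set X := closure[weakTop F] (convexHull ℝ (Set.range f)) with hCdef
  have hsub : convexHull ℝ (Set.range f) ⊆ C := @subset_closure _ (weakTop F) _
  have hev : @Continuous X (F → ℂ) (weakTop F) _ ev := continuous_induced_dom
  have himage : IsCompact (ev '' C) := @IsCompact.image _ _ (weakTop F) _ _ _ hC hev
  let p₀ : F → ℂ := fun φ => ∫ k, (φ : StrongDual ℂ X) (f k) ∂μ
  -- The image of $C$ is compact, hence closed, so finitely many functionals at a time suffice.
  -- There the integral is finite-dimensional and lies in the closed convex hull of the range.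
  have hp₀ : p₀ ∈ ev '' C := by
    rw [← himage.isClosed.closure_eq, mem_closure_iff]
    intro U hU hpU
    obtain ⟨I, u, hu, hIu⟩ := isOpen_pi_iff.1 hU p₀ hpU
    let T : X →ₗ[ℝ] (I → ℂ) :=
      LinearMap.pi fun i => ((i.1 : StrongDual ℂ X) : X →ₗ[ℂ] ℂ).restrictScalars ℝ
    have hTf : Continuous fun k => T (f k) := continuous_pi fun i => hf _ i.1.2
    have hint : Integrable (fun k => T (f k)) μ :=
      hTf.integrable_of_hasCompactSupport (HasCompactSupport.of_compactSpace _)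
    have hmem : (∫ k, T (f k) ∂μ) ∈ closure (T '' convexHull ℝ (Set.range f)) := by
      refine Convex.integral_mem ((convex_convexHull ℝ _).linear_image T).closure isClosed_closure
        (Filter.Eventually.of_forall fun k => subset_closure ⟨f k, ?_, rfl⟩) hint
      exact subset_convexHull ℝ _ ⟨k, rfl⟩
    have hcoord : ∀ i : I, (∫ k, T (f k) ∂μ) i = p₀ i.1 := fun i =>
      ((ContinuousLinearMap.proj (R := ℝ) (φ := fun _ : I => ℂ) i).integral_comp_comm hint).symm
    obtain ⟨_, hv, ⟨x, hx, rfl⟩⟩ := mem_closure_iff.1 hmem (Set.univ.pi fun i : I => u i.1)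
      (isOpen_set_pi Set.finite_univ fun i _ => (hu i.1 i.2).1)
      (fun i _ => by rw [hcoord]; exact (hu i.1 i.2).2)
    exact ⟨ev x, hIu fun i hi => hv ⟨i, hi⟩ trivial, ⟨x, hsub hx, rfl⟩⟩
  obtain ⟨p, hp, hpe⟩ := hp₀
  refine ⟨p, fun φ hφ => congrFun hpe ⟨φ, hφ⟩, fun S hS hconv hfS => ?_⟩
  have h1 : C ⊆ S := @closure_minimal _ (weakTop F) _ _
    (convexHull_min (Set.range_subset_iff.2 hfS) hconv) hS
  exact h1 hp

end WeakIntegral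

/-! ### Averaging over $G$ and the abundance of fixed points. -/

section FixedPoints

open MeasureTheory

variable {X : Type*} [NonUnitalCStarAlgebra X] {G : Type*} [Group G] [TopologicalSpace G]
  {F : Submodule ℂ (StrongDual ℂ X)} {α : G →* (X ≃⋆ₐ[ℂ] X)}

theorem IsFDynamicalSystem.comp_mul_right_mem (hα : IsFDynamicalSystem F α) {φ : StrongDual ℂ X}
    (hφ : φ ∈ F) (a : X) : φ.comp ((ContinuousLinearMap.mul ℂ X).flip a) ∈ F := by
  obtain ⟨ψ, hψ, h⟩ := exists_mem_eq_of_continuous_weakTop (F := F)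
    (φ.comp ((ContinuousLinearMap.mul ℂ X).flip a)).toLinearMap
    (continuous_weakTop_apply_comp hφ (hα.continuous_mul_right a))
  convert hψ
  ext x
  exact (h x).symm

theorem IsFDynamicalSystem.comp_mul_left_mem (hα : IsFDynamicalSystem F α) {φ : StrongDual ℂ X}
    (hφ : φ ∈ F) (a : X) : φ.comp (ContinuousLinearMap.mul ℂ X a) ∈ F := by
  obtain ⟨ψ, hψ, h⟩ := exists_mem_eq_of_continuous_weakTop (F := F)
    (φ.comp (ContinuousLinearMap.mul ℂ X a)).toLinearMap
    (continuous_weakTop_apply_comp hφ (hα.continuous_mul_left a))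
  convert hψ
  ext x
  exact (h x).symm

theorem IsFDynamicalSystem.exists_mem_eq_comp (hα : IsFDynamicalSystem F α) {φ : StrongDual ℂ X}
    (hφ : φ ∈ F) (g : G) : ∃ ψ ∈ F, ∀ x, ψ x = φ (α g x) :=
  exists_mem_eq_of_continuous_weakTop (F := F)
    { toFun := fun x => φ (α g x), map_add' := by simp, map_smul' := by simp }
    (continuous_weakTop_apply_comp hφ (hα.continuous_automorphism g))

/-- The fixed points of an invariant `F`-closed star subalgebra `Y` have no right annihilator. -/
theorem IsFDynamicalSystem.exists_fixedPoint_mul_ne_zero [PartialOrder X] [StarOrderedRing X]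
    [IsTopologicalGroup G] [CompactSpace G] [T2Space G] (hα : IsFDynamicalSystem F α)
    {Y : NonUnitalStarSubalgebra ℂ X} (hinv : ∀ g, ∀ y ∈ Y, α g y ∈ Y)
    (hclosed : IsClosed[weakTop F] (Y : Set X)) {u : X} (hu : u ∈ Y) (hu0 : u ≠ 0) :
    ∃ y ∈ Y, y ∈ fixedPoints α ∧ u * y ≠ 0 := by
  borelize G
  let μ : Measure G := Measure.haarMeasure ⊤
  have : IsProbabilityMeasure μ := ⟨Measure.haarMeasure_self⟩
  set b := star u * u with hb
  have hbY : b ∈ Y := mul_mem (star_mem hu) hu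
  obtain ⟨p, hp, hpS⟩ := hα.isDualPair.exists_weak_integral μ (f := fun g => α g b)
    (hα.continuous_orbit b)
  refine ⟨p, hpS Y hclosed ?_ fun g => hinv g b hbY, fun h => ?_, fun h0 => ?_⟩
  · exact (Y.toSubmodule.restrictScalars ℝ).convex
  · rw [← sub_eq_zero]
    refine hα.isDualPair.eq_zero_of_forall fun φ hφ => ?_
    -- Since $\varphi\circ\alpha_h\in\mathcal F$, the automorphism passes inside the weak integral,
    -- where left invariance of Haar measure absorbs it.
    obtain ⟨ψ, hψ, hψe⟩ := hα.exists_mem_eq_comp hφ h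
    rw [map_sub, ← hψe, hp ψ hψ, hp φ hφ, sub_eq_zero]
    have h1 : ∀ g, ψ (α g b) = φ (α (h * g) b) := fun g => by rw [hψe, map_mul α]; rfl
    simp_rw [h1]
    exact integral_mul_left_eq_self (fun g => φ (α g b)) h
  · have hz0 : u * b * star u ≠ 0 := by
      have h1 : u * b * star u = (u * star u) * star (u * star u) := by
        simp only [hb, star_mul, star_star, mul_assoc]
      rw [h1, Ne, CStarRing.mul_star_self_eq_zero_iff, CStarRing.mul_star_self_eq_zero_iff]
      exact hu0
    obtain ⟨ψ, hψ, hpos, hne⟩ := exists_nonneg_functional_apply_ne_zero hα.isDualPair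
      (fun φ hφ a => hα.comp_mul_right_mem hφ a)
      (star_right_conjugate_nonneg (star_mul_self_nonneg u) u) hz0
    -- If $up=0$, then $\theta=\psi(u\cdot u^*)$ vanishes at $p$. But
    -- $g\mapsto\mathrm{Re}\,\theta(\alpha_g(b))$ is continuous, nonnegative, and nonzero at $g=1$,
    -- so its integral is positive.
    have hθ := hα.comp_mul_left_mem (hα.comp_mul_right_mem hψ (star u)) u
    set θ := (ψ.comp ((ContinuousLinearMap.mul ℂ X).flip (star u))).comp
      (ContinuousLinearMap.mul ℂ X u)
    have hθe : ∀ x, θ x = ψ (u * x * star u) := fun x => rfl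
    have hθc := hα.continuous_orbit b θ hθ
    have hint : Integrable (fun g => θ (α g b)) μ :=
      hθc.integrable_of_hasCompactSupport (HasCompactSupport.of_compactSpace _)
    have h1 : ∫ g, (θ (α g b)).re ∂μ = 0 := by
      have h2 : ∫ g, (θ (α g b)).re ∂μ = (∫ g, θ (α g b) ∂μ).re := integral_re hint
      rw [h2, ← hp θ hθ, hθe, h0, zero_mul, map_zero, Complex.zero_re]
    have h3 : 0 < ∫ g, (θ (α g b)).re ∂μ := by
      refine Continuous.integral_pos_of_hasCompactSupport_nonneg_nonzero (x := 1)
        (Complex.continuous_re.comp hθc) (HasCompactSupport.of_compactSpace _) (fun g => ?_) ?_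
      · refine (hpos _ (star_right_conjugate_nonneg ?_ u)).1
        rw [hb, map_mul, map_star]
        exact star_mul_self_nonneg _
      · rw [map_one]; exact hne
    exact h3.ne' h1

end FixedPoints

/-! ### Scalar matrices acting on $X\otimes M_n(\mathbb C)$. -/

section MatrixActions

variable {X : Type*} [NonUnitalCStarAlgebra X] {n : ℕ}

theorem mulScalarMatrix_mul_eq (a b : Matrix (Fin n) (Fin n) X) (u : Matrix (Fin n) (Fin n) ℂ) :
    mulScalarMatrix (a * b) u = a * mulScalarMatrix b u := by
  ext i j
  simp only [mulScalarMatrix, Matrix.of_apply, Matrix.mul_apply, Finset.smul_sum, Finset.mul_sum,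
    mul_smul_comm]
  exact Finset.sum_comm

theorem mul_scalarMatrixMul (a b : Matrix (Fin n) (Fin n) X) (u : Matrix (Fin n) (Fin n) ℂ) :
    a * scalarMatrixMul u b = mulScalarMatrix a u * b := by
  ext i j
  simp only [mulScalarMatrix, scalarMatrixMul, Matrix.of_apply, Matrix.mul_apply, Finset.mul_sum,
    Finset.sum_mul, mul_smul_comm, smul_mul_assoc]
  exact Finset.sum_comm

theorem mulScalarMatrix_mulScalarMatrix (a : Matrix (Fin n) (Fin n) X)
    (u v : Matrix (Fin n) (Fin n) ℂ) :
    mulScalarMatrix (mulScalarMatrix a u) v = mulScalarMatrix a (u * v) := by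
  ext i j
  simp only [mulScalarMatrix, Matrix.of_apply, Matrix.mul_apply, Finset.smul_sum,
    Finset.sum_smul, smul_smul]
  rw [Finset.sum_comm]
  simp only [mul_comm]

theorem scalarMatrixMul_scalarMatrixMul (a : Matrix (Fin n) (Fin n) X)
    (u v : Matrix (Fin n) (Fin n) ℂ) :
    scalarMatrixMul u (scalarMatrixMul v a) = scalarMatrixMul (u * v) a := by
  ext i j
  simp only [scalarMatrixMul, Matrix.of_apply, Matrix.mul_apply, Finset.smul_sum,
    Finset.sum_smul, smul_smul]
  rw [Finset.sum_comm]

theorem scalarMatrixMul_mulScalarMatrix (a : Matrix (Fin n) (Fin n) X)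
    (u v : Matrix (Fin n) (Fin n) ℂ) :
    scalarMatrixMul u (mulScalarMatrix a v) = mulScalarMatrix (scalarMatrixMul u a) v := by
  ext i j
  simp only [mulScalarMatrix, scalarMatrixMul, Matrix.of_apply, Finset.smul_sum, smul_smul]
  rw [Finset.sum_comm]
  simp only [mul_comm]

theorem mulScalarMatrix_one (a : Matrix (Fin n) (Fin n) X) : mulScalarMatrix a 1 = a := by
  ext i j
  simp [mulScalarMatrix, Matrix.one_apply]

theorem scalarMatrixMul_one (a : Matrix (Fin n) (Fin n) X) : scalarMatrixMul 1 a = a := by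
  ext i j
  simp [scalarMatrixMul, Matrix.one_apply]

theorem conjTranspose_mulScalarMatrix (a : Matrix (Fin n) (Fin n) X)
    (u : Matrix (Fin n) (Fin n) ℂ) :
    (mulScalarMatrix a u).conjTranspose = scalarMatrixMul u.conjTranspose a.conjTranspose := by
  ext i j
  simp [mulScalarMatrix, scalarMatrixMul, star_sum]

theorem conjTranspose_scalarMatrixMul (a : Matrix (Fin n) (Fin n) X)
    (u : Matrix (Fin n) (Fin n) ℂ) :
    (scalarMatrixMul u a).conjTranspose = mulScalarMatrix a.conjTranspose u.conjTranspose := by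
  ext i j
  simp [mulScalarMatrix, scalarMatrixMul, star_sum]

theorem mulScalarMatrix_mul_diagonal (a : Matrix (Fin n) (Fin n) X)
    (u : Matrix (Fin n) (Fin n) ℂ) (y : X) :
    mulScalarMatrix a u * Matrix.diagonal (fun _ => y)
      = mulScalarMatrix (a * Matrix.diagonal (fun _ => y)) u := by
  ext i j
  simp [mulScalarMatrix, Matrix.mul_diagonal, Finset.sum_mul, smul_mul_assoc]

theorem scalarMatrixMul_mul_eq (a b : Matrix (Fin n) (Fin n) X) (u : Matrix (Fin n) (Fin n) ℂ) :
    scalarMatrixMul u (a * b) = scalarMatrixMul u a * b := by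
  ext i j
  simp only [scalarMatrixMul, Matrix.of_apply, Matrix.mul_apply, Finset.smul_sum, Finset.sum_mul,
    smul_mul_assoc]
  exact Finset.sum_comm

theorem diagonal_mul_scalarMatrixMul (a : Matrix (Fin n) (Fin n) X)
    (u : Matrix (Fin n) (Fin n) ℂ) (y : X) :
    scalarMatrixMul u (Matrix.diagonal (fun _ => y) * a)
      = Matrix.diagonal (fun _ => y) * scalarMatrixMul u a := by
  ext i j
  simp [scalarMatrixMul, Matrix.diagonal_mul, Finset.mul_sum, mul_smul_comm]

theorem Matrix.conjTranspose_diagonal_const (y : X) :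
    (Matrix.diagonal fun _ : Fin n => y).conjTranspose = Matrix.diagonal fun _ => star y :=
  Matrix.diagonal_conjTranspose _

/-- Each diagonal entry of $aa^*$ is a sum of positive elements $a_{ik}a_{ik}^*$, so all of these
vanish. No C*-norm on matrices is involved. -/
theorem Matrix.eq_zero_of_mul_conjTranspose_eq_zero [PartialOrder X] [StarOrderedRing X]
    {a : Matrix (Fin n) (Fin n) X} (h : a * a.conjTranspose = 0) : a = 0 := by
  ext i j
  have h1 : ∑ k, a i k * star (a i k) = 0 := by
    have := congrFun (congrFun h i) i
    simpa [Matrix.mul_apply] using this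
  rw [Finset.sum_eq_zero_iff_of_nonneg fun k _ => mul_star_self_nonneg _] at h1
  simpa using (CStarRing.mul_star_self_eq_zero_iff _).1 (h1 j (Finset.mem_univ j))

theorem Matrix.eq_zero_of_conjTranspose_mul_eq_zero [PartialOrder X] [StarOrderedRing X]
    {a : Matrix (Fin n) (Fin n) X} (h : a.conjTranspose * a = 0) : a = 0 := by
  rw [← Matrix.conjTranspose_eq_zero]
  exact Matrix.eq_zero_of_mul_conjTranspose_eq_zero (by simpa using h)

end MatrixActions

/-! ### Entrywise automorphisms and fixed diagonal matrices. -/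

section FixedPointMatrices

variable {X : Type*} [NonUnitalCStarAlgebra X] {G : Type*} [Group G] {α : G →* (X ≃⋆ₐ[ℂ] X)}

theorem star_mem_fixedPoints {x : X} (hx : x ∈ fixedPoints α) : star x ∈ fixedPoints α :=
  fun g => by rw [map_star, hx g]

theorem Matrix.map_mul_starAlgEquiv {n : ℕ} (f : X ≃⋆ₐ[ℂ] X) (a b : Matrix (Fin n) (Fin n) X) :
    (a * b).map (fun x => f x) = a.map (fun x => f x) * b.map (fun x => f x) := by
  ext i j
  simp [Matrix.mul_apply, map_sum]

theorem map_diagonal_of_mem_fixedPoints {n : ℕ} {x : X} (hx : x ∈ fixedPoints α) (g : G) :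
    (Matrix.diagonal (fun _ : Fin n => x)).map (fun x => α g x)
      = Matrix.diagonal (fun _ => x) := by
  rw [Matrix.diagonal_map (map_zero _)]
  congr 1
  ext i
  exact hx g

end FixedPointMatrices

/-! ### Module structure of the spectral subspaces. -/

section SpectralSubspaces

variable {X : Type*} [NonUnitalCStarAlgebra X] {G : Type*} [Group G] [TopologicalSpace G]
  {F : Submodule ℂ (StrongDual ℂ X)} {α : G →* (X ≃⋆ₐ[ℂ] X)}

variable (π : UnitaryIrrep G)

theorem UnitaryIrrep.mat_mul_mat_inv (g : G) : π.mat g * π.mat g⁻¹ = 1 := by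
  simp only [UnitaryIrrep.mat]
  rw [← Submonoid.coe_mul, ← map_mul, mul_inv_cancel, map_one, Submonoid.coe_one]

theorem UnitaryIrrep.mat_inv_mul_mat (g : G) : π.mat g⁻¹ * π.mat g = 1 := by
  simpa using π.mat_mul_mat_inv g⁻¹

theorem UnitaryIrrep.conjTranspose_mat (g : G) : (π.mat g).conjTranspose = π.mat g⁻¹ := by
  simp only [UnitaryIrrep.mat]
  rw [map_inv]
  rfl

variable {π}

/-- Moving $1\otimes\pi_{g^{-1}}$ to the other side gives an intertwining relation, which is easier
to multiply. -/
theorem mem_adFixedPoints_iff {Y : Set X} {a : Matrix (Fin π.dim) (Fin π.dim) X} :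
    a ∈ adFixedPoints α Y π ↔ (∀ i j, a i j ∈ Y) ∧
      ∀ g, scalarMatrixMul (π.mat g) (a.map fun x => α g x) = mulScalarMatrix a (π.mat g) := by
  refine and_congr_right fun _ => forall_congr' fun g => ⟨fun h => ?_, fun h => ?_⟩
  · conv_rhs => rw [← h]
    rw [mulScalarMatrix_mulScalarMatrix, π.mat_inv_mul_mat, mulScalarMatrix_one]
  · rw [h, mulScalarMatrix_mulScalarMatrix, π.mat_mul_mat_inv, mulScalarMatrix_one]

theorem conjTranspose_mem_adFixedPoints {Y : NonUnitalStarSubalgebra ℂ X}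
    {a : Matrix (Fin π.dim) (Fin π.dim) X} (ha : a ∈ adFixedPoints α (Y : Set X) π) :
    a.conjTranspose ∈ adFixedPoints α (Y : Set X) π := by
  rw [mem_adFixedPoints_iff] at ha ⊢
  refine ⟨fun i j => star_mem (ha.1 j i), fun g => ?_⟩
  have h1 := congrArg Matrix.conjTranspose (ha.2 g)
  rw [conjTranspose_mulScalarMatrix, conjTranspose_scalarMatrixMul, π.conjTranspose_mat] at h1
  have h2 : (a.map fun x => α g x).conjTranspose = a.conjTranspose.map fun x => α g x := by
    ext i j
    simp [map_star]
  rw [h2] at h1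
  have h3 := congrArg (fun m => scalarMatrixMul (π.mat g) (mulScalarMatrix m (π.mat g))) h1
  simp only [mulScalarMatrix_mulScalarMatrix, π.mat_inv_mul_mat, mulScalarMatrix_one] at h3
  rw [h3, scalarMatrixMul_mulScalarMatrix, scalarMatrixMul_scalarMatrixMul, π.mat_mul_mat_inv,
    scalarMatrixMul_one]

theorem diagonal_mul_mul_diagonal_mem_adFixedPoints {Y Z : Set X}
    {a : Matrix (Fin π.dim) (Fin π.dim) X} (ha : a ∈ adFixedPoints α Y π) {x y : X}
    (hx : x ∈ fixedPoints α) (hy : y ∈ fixedPoints α) (hZ : ∀ z ∈ Y, x * z * y ∈ Z) :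
    Matrix.diagonal (fun _ => x) * a * Matrix.diagonal (fun _ => y) ∈ adFixedPoints α Z π := by
  rw [mem_adFixedPoints_iff] at ha ⊢
  refine ⟨fun i j => ?_, fun g => ?_⟩
  · rw [Matrix.mul_diagonal, Matrix.diagonal_mul]
    exact hZ _ (ha.1 i j)
  · rw [Matrix.map_mul_starAlgEquiv, Matrix.map_mul_starAlgEquiv,
      map_diagonal_of_mem_fixedPoints hx, map_diagonal_of_mem_fixedPoints hy,
      scalarMatrixMul_mul_eq, diagonal_mul_scalarMatrixMul, ha.2 g, ← mulScalarMatrix_mul_eq,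
      mulScalarMatrix_mul_diagonal]

theorem spectralSubspace_mono {Y Z : Set X} (h : Y ⊆ Z) :
    spectralSubspace α Y π ⊆ spectralSubspace α Z π :=
  fun _ ha => ⟨fun i j => h (ha.1 i j), ha.2⟩

theorem diagonal_mul_mem_spectralSubspace {a : Matrix (Fin π.dim) (Fin π.dim) X}
    (ha : a ∈ spectralSubspace α Set.univ π) {x : X} (hx : x ∈ fixedPoints α) :
    Matrix.diagonal (fun _ => x) * a ∈ spectralSubspace α Set.univ π := by
  refine ⟨fun i j => trivial, fun g => ?_⟩
  rw [Matrix.map_mul_starAlgEquiv, map_diagonal_of_mem_fixedPoints hx, ha.2 g,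
    mulScalarMatrix_mul_eq]

theorem mul_diagonal_mem_spectralSubspace {a : Matrix (Fin π.dim) (Fin π.dim) X}
    (ha : a ∈ spectralSubspace α Set.univ π) {x : X} (hx : x ∈ fixedPoints α) :
    a * Matrix.diagonal (fun _ => x) ∈ spectralSubspace α Set.univ π := by
  refine ⟨fun i j => trivial, fun g => ?_⟩
  rw [Matrix.map_mul_starAlgEquiv, map_diagonal_of_mem_fixedPoints hx, ha.2 g,
    mulScalarMatrix_mul_diagonal]

/-- $\alpha_g(ca)=c(1\otimes\pi_g)\alpha_g(a)=ca(1\otimes\pi_g)$. -/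
theorem mul_mem_spectralSubspace {Y : Set X} {c a : Matrix (Fin π.dim) (Fin π.dim) X}
    (hc : c ∈ spectralSubspace α Set.univ π) (ha : a ∈ adFixedPoints α Y π) :
    c * a ∈ spectralSubspace α Set.univ π := by
  refine ⟨fun i j => trivial, fun g => ?_⟩
  rw [Matrix.map_mul_starAlgEquiv, hc.2 g, ← mul_scalarMatrixMul,
    (mem_adFixedPoints_iff.1 ha).2 g, mulScalarMatrix_mul_eq]

theorem conjTranspose_mul_mem_spectralIdeal {Y : Set X}
    {c d : Matrix (Fin π.dim) (Fin π.dim) X} (hc : c ∈ spectralSubspace α Y π)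
    (hd : d ∈ spectralSubspace α Y π) : c.conjTranspose * d ∈ spectralIdeal F α Y π := by
  refine @subset_closure _ (weakMatrixTop F π.dim) _ _ (Submodule.subset_span ?_)
  exact ⟨c, hc, d, hd, rfl⟩

/-- Left multiplication by $a$ is $\mathcal F$-continuous entrywise, so its kernel is an $\mathcal
F$-closed subspace. It therefore suffices to kill the left factors $c^*$ of the generators. -/
theorem IsFDynamicalSystem.mul_eq_zero_of_mem_spectralIdeal (hα : IsFDynamicalSystem F α)
    {Y : Set X} {a b : Matrix (Fin π.dim) (Fin π.dim) X}
    (h : ∀ c ∈ spectralSubspace α Y π, a * c.conjTranspose = 0)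
    (hb : b ∈ spectralIdeal F α Y π) : a * b = 0 := by
  have hclosed : IsClosed[weakMatrixTop F π.dim] {b : Matrix (Fin π.dim) (Fin π.dim) X |
      a * b = 0} := by
    have heq : {b : Matrix (Fin π.dim) (Fin π.dim) X | a * b = 0}
        = ⋂ p : F × Fin π.dim × Fin π.dim, {b | ∑ k, (p.1.1.comp
          (ContinuousLinearMap.mul ℂ X (a p.2.1 k))) (b k p.2.2) = 0} := by
      ext b
      simp only [Set.mem_ofPred_eq, Set.mem_iInter]
      constructor
      · rintro hb ⟨φ, i, j⟩
        have h1 := congrArg φ.1 (congrFun (congrFun hb i) j)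
        simpa [Matrix.mul_apply, map_sum] using h1
      · intro hb
        ext i j
        refine hα.isDualPair.eq_zero_of_forall fun φ hφ => ?_
        simpa [Matrix.mul_apply, map_sum] using hb (⟨φ, hφ⟩, i, j)
    rw [heq]
    refine @isClosed_iInter _ _ (weakMatrixTop F π.dim) _ fun p => ?_
    refine @IsClosed.preimage _ ℂ (weakMatrixTop F π.dim) _ _ ?_ _ (isClosed_singleton (x := 0))
    let _ := weakMatrixTop F π.dim
    refine continuous_finsetSum _ fun k _ => ?_
    have hk : Continuous fun v : F × Fin π.dim × Fin π.dim → ℂ =>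
        v (⟨_, hα.comp_mul_left_mem p.1.2 (a p.2.1 k)⟩, k, p.2.2) := continuous_apply _
    exact @Continuous.comp (Matrix (Fin π.dim) (Fin π.dim) X)
      (F × Fin π.dim × Fin π.dim → ℂ) ℂ (weakMatrixTop F π.dim) _ _
      (fun (a : Matrix (Fin π.dim) (Fin π.dim) X) (p : F × Fin π.dim × Fin π.dim) =>
        (p.1 : StrongDual ℂ X) (a p.2.1 p.2.2)) _ hk continuous_induced_dom
  have hsub : spectralIdeal F α Y π ⊆ {b | a * b = 0} := by
    refine @closure_minimal _ (weakMatrixTop F π.dim) _ _ ?_ hclosed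
    intro b hb
    refine Submodule.span_induction ?_ (Matrix.mul_zero a) (fun x y _ _ hx hy => ?_)
      (fun c x _ hx => ?_) hb
    · rintro _ ⟨c, hc, d, -, rfl⟩
      show a * (c.conjTranspose * d) = 0
      rw [← Matrix.mul_assoc, h c hc, Matrix.zero_mul]
    · show a * (x + y) = 0
      rw [Matrix.mul_add, show a * x = 0 from hx, show a * y = 0 from hy, add_zero]
    · show a * (c • x) = 0
      rw [Matrix.mul_smul, show a * x = 0 from hx, smul_zero]
  exact hsub hb

end SpectralSubspaces

/-! ### Passing algebraic operations to $\mathcal F$-closures. -/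

section WeakClosure

variable {X : Type*} [NormedAddCommGroup X] [NormedSpace ℂ X] {F : Submodule ℂ (StrongDual ℂ X)}

theorem continuous_weakTop_iff {f : X → X} :
    Continuous[weakTop F, weakTop F] f ↔
      ∀ φ ∈ F, Continuous[weakTop F, inferInstance] fun x => φ (f x) := by
  let _ : TopologicalSpace X := weakTop F
  exact continuous_weakTop_rng

theorem continuous_weakTop_const_add (x : X) :
    Continuous[weakTop F, weakTop F] fun y : X => x + y := by
  rw [continuous_weakTop_iff]
  intro φ hφ
  have h := continuous_weakTop_apply hφ
  simp only [map_add]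
  exact @Continuous.add _ _ _ _ _ (weakTop F) _ _ (@continuous_const _ _ (weakTop F) _ _) h

theorem continuous_weakTop_add_const (x : X) :
    Continuous[weakTop F, weakTop F] fun y : X => y + x := by
  simpa only [add_comm] using continuous_weakTop_const_add x

theorem continuous_weakTop_smul (c : ℂ) :
    Continuous[weakTop F, weakTop F] fun y : X => c • y := by
  rw [continuous_weakTop_iff]
  intro φ hφ
  have h := continuous_weakTop_apply hφ
  simp only [map_smul, smul_eq_mul]
  exact @Continuous.mul _ _ _ _ _ (weakTop F) _ _ (@continuous_const _ _ (weakTop F) _ _) h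

theorem map_mem_closure_weakTop {S : Set X} {f : X → X} (hf : Continuous[weakTop F, weakTop F] f)
    (h : ∀ x ∈ S, f x ∈ closure[weakTop F] S) {x : X} (hx : x ∈ closure[weakTop F] S) :
    f x ∈ closure[weakTop F] S := by
  have hsub : closure[weakTop F] S ⊆ f ⁻¹' closure[weakTop F] S :=
    @closure_minimal _ (weakTop F) _ _ h
      (@IsClosed.preimage _ _ (weakTop F) (weakTop F) _ hf _ (@isClosed_closure _ (weakTop F) S))
  exact hsub hx

/-- Only separate continuity is available, so the closure is reached one variable at a time. -/
theorem map₂_mem_closure_weakTop {S : Set X} {op : X → X → X}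
    (hl : ∀ x, Continuous[weakTop F, weakTop F] fun y => op x y)
    (hr : ∀ y, Continuous[weakTop F, weakTop F] fun x => op x y)
    (h : ∀ x ∈ S, ∀ y ∈ S, op x y ∈ S) {x y : X} (hx : x ∈ closure[weakTop F] S)
    (hy : y ∈ closure[weakTop F] S) : op x y ∈ closure[weakTop F] S := by
  have h1 : ∀ x ∈ S, ∀ y ∈ closure[weakTop F] S, op x y ∈ closure[weakTop F] S :=
    fun x hx y hy => map_mem_closure_weakTop (hl x)
      (fun y hy => @subset_closure _ (weakTop F) _ _ (h x hx y hy)) hy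
  exact map_mem_closure_weakTop (hr y) (fun x hx => h1 x hx y hy) hx

theorem IsDualPair.isClosed_setOf_eq_zero (hF : IsDualPair F) {f : X → X}
    (hf : Continuous[weakTop F, weakTop F] f) : IsClosed[weakTop F] {x | f x = 0} := by
  have heq : {x | f x = 0} = ⋂ φ : F, {x | (φ : StrongDual ℂ X) (f x) = 0} := by
    ext x
    simp only [Set.mem_ofPred_eq, Set.mem_iInter]
    exact ⟨fun h φ => by rw [h, map_zero], fun h => hF.eq_zero_of_forall fun φ hφ => h ⟨φ, hφ⟩⟩
  rw [heq]
  refine @isClosed_iInter _ _ (weakTop F) _ fun φ => ?_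
  exact @IsClosed.preimage _ ℂ (weakTop F) _ _ (continuous_weakTop_apply_comp φ.2 hf) _
    (isClosed_singleton (x := 0))

end WeakClosure

/-! ### The corner $\overline{JXJ}^\sigma$ as a hereditary subalgebra. -/

section IdealCorner

variable {X : Type*} [NonUnitalCStarAlgebra X] {G : Type*} [Group G]
  {F : Submodule ℂ (StrongDual ℂ X)} {α : G →* (X ≃⋆ₐ[ℂ] X)} {J : Submodule ℂ X}

/-- The usual argument that closed ideals are self-adjoint: $j^*=\lim j^*e_n$ with $e_n\in J$ an
approximate unit built from $jj^*$. -/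
theorem IsFixedPointIdeal.star_mem [PartialOrder X] [StarOrderedRing X]
    (hJ : IsFixedPointIdeal F α J) {j : X} (hj : j ∈ J) : star j ∈ J := by
  have hclosed : IsClosed (J : Set X) := isClosed_of_isClosed_weakTop hJ.isClosed
  -- $J\cap J^*$ is a closed star subalgebra containing $jj^*$, so functional calculus stays inside
  -- it.
  let S : NonUnitalStarSubalgebra ℂ X :=
    { carrier := {x | x ∈ J ∧ star x ∈ J}
      add_mem' := fun ha hb => ⟨add_mem ha.1 hb.1, by rw [star_add]; exact add_mem ha.2 hb.2⟩
      zero_mem' := ⟨zero_mem J, by rw [star_zero]; exact zero_mem J⟩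
      mul_mem' := fun ha hb => ⟨hJ.mul_mem_left _ (hJ.subset ha.1) _ hb.1, by
        rw [star_mul]; exact hJ.mul_mem_left _ (hJ.subset hb.2) _ ha.2⟩
      smul_mem' := fun c x hx => ⟨J.smul_mem c hx.1, by
        rw [star_smul]; exact J.smul_mem _ hx.2⟩
      star_mem' := fun hx => ⟨hx.2, by rw [star_star]; exact hx.1⟩ }
  have hS : IsClosed (S : Set X) := hclosed.inter (hclosed.preimage continuous_star)
  have hjj : j * star j ∈ S := by
    have h := hJ.mul_mem_right _ (star_mem_fixedPoints (hJ.subset hj)) _ hj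
    exact ⟨h, by rw [star_mul, star_star]; exact h⟩
  obtain ⟨e, he, heS, hlim⟩ := exists_approximate_unit_of_nonneg (mul_star_self_nonneg j)
  refine hclosed.mem_of_tendsto (hlim j le_rfl).star (Filter.Eventually.of_forall fun n => ?_)
  rw [star_mul, he]
  exact hJ.mul_mem_left _ (star_mem_fixedPoints (hJ.subset hj)) _ (heS S hS hjj n).1

theorem mul_mul_mem_idealCorner {j k : X} (hj : j ∈ J) (x : X) (hk : k ∈ J) :
    j * x * k ∈ idealCorner F J :=
  @subset_closure _ (weakTop F) _ _ (Submodule.subset_span ⟨j, hj, x, k, hk, rfl⟩)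

theorem idealCorner_subset {T : Submodule ℂ X} (hT : IsClosed[weakTop F] (T : Set X))
    (h : ∀ j ∈ J, ∀ x : X, ∀ k ∈ J, j * x * k ∈ T) : idealCorner F J ⊆ T := by
  refine @closure_minimal _ (weakTop F) _ _ ?_ hT
  refine Submodule.span_le.2 ?_
  rintro _ ⟨j, hj, x, k, hk, rfl⟩
  exact h j hj x k hk

variable [TopologicalSpace G]

theorem IsFDynamicalSystem.mul_mul_mem_idealCorner (hα : IsFDynamicalSystem F α) {s t : X}
    (hs : s ∈ idealCorner F J) (w : X) (ht : t ∈ idealCorner F J) :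
    s * w * t ∈ idealCorner F J := by
  refine map₂_mem_closure_weakTop (op := fun s t => s * w * t)
    (fun s => hα.continuous_mul_left (s * w))
    (fun t => ?_) (fun s hs t ht => ?_) hs ht
  · simpa only [mul_assoc] using hα.continuous_mul_right (w * t)
  · refine LinearMap.BilinMap.apply_apply_mem_of_mem_span _ _ _
      ((LinearMap.mul ℂ X).comp (LinearMap.mulRight ℂ w)) ?_ s t hs ht
    rintro _ ⟨j, hj, x, k, hk, rfl⟩ _ ⟨j', hj', x', k', hk', rfl⟩
    refine Submodule.subset_span ⟨j, hj, x * k * w * j' * x', k', hk', ?_⟩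
    simp [mul_assoc]

theorem IsFDynamicalSystem.mul_mem_idealCorner (hα : IsFDynamicalSystem F α) {s t : X}
    (hs : s ∈ idealCorner F J) (ht : t ∈ idealCorner F J) :
    s * t ∈ idealCorner F J := by
  refine map₂_mem_closure_weakTop (op := fun s t => s * t) hα.continuous_mul_left
    hα.continuous_mul_right (fun s hs t ht => ?_) hs ht
  refine LinearMap.BilinMap.apply_apply_mem_of_mem_span _ _ _ (LinearMap.mul ℂ X) ?_ s t hs ht
  rintro _ ⟨j, hj, x, k, hk, rfl⟩ _ ⟨j', hj', x', k', hk', rfl⟩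
  refine Submodule.subset_span ⟨j, hj, x * k * j' * x', k', hk', ?_⟩
  simp [mul_assoc]

variable [PartialOrder X] [StarOrderedRing X]

/-- The `F`-closed corner of an ideal of the fixed point algebra, as a star subalgebra. -/
def IsFDynamicalSystem.cornerSubalgebra (hα : IsFDynamicalSystem F α)
    (hJ : IsFixedPointIdeal F α J) : NonUnitalStarSubalgebra ℂ X where
  carrier := idealCorner F J
  add_mem' := fun hx hy => map₂_mem_closure_weakTop continuous_weakTop_const_add
    continuous_weakTop_add_const (fun _ hx _ hy => add_mem hx hy) hx hy
  zero_mem' := @subset_closure _ (weakTop F) _ _ (zero_mem (Submodule.span ℂ _))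
  mul_mem' := hα.mul_mem_idealCorner
  smul_mem' := fun c _ hx => map_mem_closure_weakTop (continuous_weakTop_smul c)
    (fun _ hx => @subset_closure _ (weakTop F) _ _ (Submodule.smul_mem (Submodule.span ℂ _) c hx))
    hx
  star_mem' := fun hx => map_mem_closure_weakTop hα.continuous_star (fun z hz => by
    refine @subset_closure _ (weakTop F) _ _ ?_
    refine Submodule.span_induction ?_ ?_ ?_ ?_ hz
    · rintro _ ⟨j, hj, x, k, hk, rfl⟩
      exact Submodule.subset_span
        ⟨star k, hJ.star_mem hk, star x, star j, hJ.star_mem hj, by simp [mul_assoc]⟩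
    · rw [star_zero]
      exact zero_mem (Submodule.span ℂ _)
    · intro x y _ _ hx hy
      rw [star_add]
      exact add_mem hx hy
    · intro c x _ hx
      rw [star_smul]
      exact Submodule.smul_mem (Submodule.span ℂ _) _ hx) hx

theorem IsFDynamicalSystem.isInvariantHereditary_cornerSubalgebra (hα : IsFDynamicalSystem F α)
    (hJ : IsFixedPointIdeal F α J) : IsInvariantHereditary F α (hα.cornerSubalgebra hJ) where
  ne_bot := by
    obtain ⟨j, hj, hj0⟩ := J.ne_bot_iff.1 hJ.ne_bot
    intro hbot
    -- By the C*-identity $jj^*j=0$ would force $j=0$.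
    have h1 : j * star j * j ∈ hα.cornerSubalgebra hJ := _root_.mul_mul_mem_idealCorner hj (star j) hj
    rw [hbot, NonUnitalStarAlgebra.mem_bot] at h1
    have h2 : (j * star j) * star (j * star j) = 0 := by
      rw [star_mul, star_star, ← mul_assoc, h1, zero_mul]
    rw [CStarRing.mul_star_self_eq_zero_iff, CStarRing.mul_star_self_eq_zero_iff] at h2
    exact hj0 h2
  invariant := fun g y hy => by
    refine map_mem_closure_weakTop (hα.continuous_automorphism g) (fun z hz => ?_) hy
    refine @subset_closure _ (weakTop F) _ _ ?_
    refine Submodule.span_induction ?_ ?_ ?_ ?_ hz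
    · rintro _ ⟨j, hj, x, k, hk, rfl⟩
      refine Submodule.subset_span ⟨j, hj, α g x, k, hk, ?_⟩
      rw [map_mul, map_mul, hJ.subset hj g, hJ.subset hk g]
    · rw [map_zero]
      exact zero_mem (Submodule.span ℂ _)
    · intro x y _ _ hx hy
      rw [map_add]
      exact add_mem hx hy
    · intro c x _ hx
      rw [map_smul]
      exact Submodule.smul_mem (Submodule.span ℂ _) _ hx
  isClosed := @isClosed_closure _ (weakTop F) _
  hereditary := fun x y hy hx hxy =>
    NonUnitalStarSubalgebra.mem_of_nonneg_of_le
      (isClosed_of_isClosed_weakTop (@isClosed_closure _ (weakTop F) _))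
      (fun _ hs _ ht w => hα.mul_mul_mem_idealCorner hs w ht) hy hx hxy

end IdealCorner

/-! ### The $\mathcal F$-closed ideal of $X^\alpha$ generated by a set. -/

section GeneratedIdeal

variable {X : Type*} [NonUnitalCStarAlgebra X] {G : Type*} [Group G]
  {F : Submodule ℂ (StrongDual ℂ X)} {α : G →* (X ≃⋆ₐ[ℂ] X)}

/-- The smallest `F`-closed subspace containing `S` and stable under multiplication by fixed
points on both sides. -/
def closedFixedPointIdeal (F : Submodule ℂ (StrongDual ℂ X)) (α : G →* (X ≃⋆ₐ[ℂ] X))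
    (S : Set X) : Submodule ℂ X :=
  sInf {N | S ⊆ N ∧ IsClosed[weakTop F] (N : Set X) ∧
    (∀ x ∈ fixedPoints α, ∀ n ∈ N, x * n ∈ N) ∧ ∀ x ∈ fixedPoints α, ∀ n ∈ N, n * x ∈ N}

theorem subset_closedFixedPointIdeal (S : Set X) : S ⊆ closedFixedPointIdeal F α S := by
  intro x hx
  simp only [closedFixedPointIdeal, SetLike.mem_coe, Submodule.mem_sInf]
  exact fun N hN => hN.1 hx

theorem closedFixedPointIdeal_le {S : Set X} {N : Submodule ℂ X} (hS : S ⊆ N)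
    (hN : IsClosed[weakTop F] (N : Set X)) (hl : ∀ x ∈ fixedPoints α, ∀ n ∈ N, x * n ∈ N)
    (hr : ∀ x ∈ fixedPoints α, ∀ n ∈ N, n * x ∈ N) : closedFixedPointIdeal F α S ≤ N :=
  sInf_le ⟨hS, hN, hl, hr⟩

variable [TopologicalSpace G]

theorem IsFDynamicalSystem.isFixedPointIdeal_closedFixedPointIdeal
    (hα : IsFDynamicalSystem F α) {S : Set X} (hS : S ⊆ fixedPoints α) {s : X} (hs : s ∈ S)
    (hs0 : s ≠ 0) : IsFixedPointIdeal F α (closedFixedPointIdeal F α S) where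
  ne_bot := fun h => hs0 (by
    have h1 := subset_closedFixedPointIdeal (F := F) (α := α) S hs
    rwa [h] at h1)
  subset := by
    -- The fixed point algebra is itself one of the subspaces in the defining intersection, being
    -- $\mathcal F$-closed as an intersection of kernels.
    let N : Submodule ℂ X :=
      { carrier := fixedPoints α
        add_mem' := fun hx hy g => by rw [map_add, hx g, hy g]
        zero_mem' := fun g => map_zero _
        smul_mem' := fun c x hx g => by rw [map_smul, hx g] }
    refine closedFixedPointIdeal_le (N := N) hS ?_ (fun x hx n hn g => ?_) fun x hx n hn g => ?_
    · have heq : (N : Set X) = ⋂ g, {x | α g x + (-1 : ℂ) • x = 0} := by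
        ext x
        simp only [Set.mem_iInter, Set.mem_ofPred_eq, neg_smul, one_smul, ← sub_eq_add_neg,
          sub_eq_zero]
        rfl
      rw [heq]
      refine @isClosed_iInter _ _ (weakTop F) _ fun g => hα.isDualPair.isClosed_setOf_eq_zero ?_
      rw [continuous_weakTop_iff]
      intro φ hφ
      simp only [map_add]
      exact @Continuous.add _ _ _ _ _ (weakTop F) _ _
        (continuous_weakTop_apply_comp hφ (hα.continuous_automorphism g))
        (continuous_weakTop_apply_comp hφ (continuous_weakTop_smul _))
    · rw [map_mul, hx g, hn g]
    · rw [map_mul, hx g, hn g]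
  isClosed := by
    simp only [closedFixedPointIdeal, Submodule.coe_sInf]
    exact @isClosed_biInter _ _ (weakTop F) _ _ fun N hN => hN.2.1
  mul_mem_left := fun x hx j hj => by
    simp only [closedFixedPointIdeal, Submodule.mem_sInf] at hj ⊢
    exact fun N hN => hN.2.2.1 x hx j (hj N hN)
  mul_mem_right := fun x hx j hj => by
    simp only [closedFixedPointIdeal, Submodule.mem_sInf] at hj ⊢
    exact fun N hN => hN.2.2.2 x hx j (hj N hN)

end GeneratedIdeal

/-! ### Transfer of essentiality from the corner to $Y$, and the theorem. -/

section ConnesSpectrum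

variable {X : Type*} [NonUnitalCStarAlgebra X] [PartialOrder X] [StarOrderedRing X]
  {G : Type*} [Group G] [TopologicalSpace G] {F : Submodule ℂ (StrongDual ℂ X)}
  {α : G →* (X ≃⋆ₐ[ℂ] X)} {π : UnitaryIrrep G} {Y : NonUnitalStarSubalgebra ℂ X}

/-- If `a` annihilates the spectral ideal of `Y`, then the entries of `a* c*`, for every element `c`
of the spectral subspace of `X`, are annihilated by the fixed points of `Y`. -/
theorem IsInvariantHereditary.conjTranspose_mul_conjTranspose_mul_eq_zero
    (hY : IsInvariantHereditary F α Y) {a : Matrix (Fin π.dim) (Fin π.dim) X}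
    (ha : a ∈ adFixedPoints α (Y : Set X) π)
    (hann : ∀ b ∈ spectralIdeal F α (Y : Set X) π, a * b = 0)
    {c : Matrix (Fin π.dim) (Fin π.dim) X} (hc : c ∈ spectralSubspace α Set.univ π) {y : X}
    (hy : y ∈ Y) (hyf : y ∈ fixedPoints α) (i k : Fin π.dim) :
    (a.conjTranspose * c.conjTranspose) i k * y = 0 := by
  set D : X → Matrix (Fin π.dim) (Fin π.dim) X := fun x => Matrix.diagonal fun _ => x with hD
  have hDstar : (D (star y)).conjTranspose = D y := by
    rw [hD, Matrix.conjTranspose_diagonal_const, star_star]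
  set d := D (star y) * (c * a) with hd
  have hdX : d ∈ spectralSubspace α Set.univ π :=
    diagonal_mul_mem_spectralSubspace (mul_mem_spectralSubspace hc ha) (star_mem_fixedPoints hyf)
  have hdY : d ∈ spectralSubspace α (Y : Set X) π := by
    refine ⟨fun i j => ?_, hdX.2⟩
    rw [hd, hD, Matrix.diagonal_mul, Matrix.mul_apply, Finset.mul_sum]
    refine sum_mem fun l _ => ?_
    rw [← mul_assoc]
    exact NonUnitalStarSubalgebra.mul_mul_mem_of_hereditary hY.hereditary (star_mem hy)
      (ha.1 l j) _
  -- $(ad^*)(ad^*)^*=a(d^*d)a^*$, and $d^*d$ lies in the spectral ideal of $Y$.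
  have h1 : a * d.conjTranspose = 0 := by
    apply Matrix.eq_zero_of_mul_conjTranspose_eq_zero
    rw [Matrix.conjTranspose_mul a, Matrix.conjTranspose_conjTranspose, ← Matrix.mul_assoc,
      Matrix.mul_assoc a, hann _ (conjTranspose_mul_mem_spectralIdeal hdY hdY), Matrix.zero_mul]
  have h2 : d.conjTranspose = a.conjTranspose * c.conjTranspose * D y := by
    rw [hd, Matrix.conjTranspose_mul, Matrix.conjTranspose_mul, hDstar]
  -- For $m=a^*c^*(1\otimes y)=d^*$, the product $m^*m$ contains the factor $ad^*=0$.
  have h3 : a.conjTranspose * c.conjTranspose * D y = 0 := by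
    apply Matrix.eq_zero_of_conjTranspose_mul_eq_zero
    rw [h2] at h1
    rw [Matrix.mul_assoc, Matrix.conjTranspose_mul, Matrix.conjTranspose_conjTranspose,
      Matrix.mul_assoc, ← Matrix.mul_assoc a.conjTranspose, h1, Matrix.mul_zero]
  have h4 := congrFun (congrFun h3 i) k
  rwa [hD, Matrix.mul_diagonal] at h4

theorem IsInvariantHereditary.mul_eq_zero_of_mem_closedFixedPointIdeal
    (hα : IsFDynamicalSystem F α) (hY : IsInvariantHereditary F α Y)
    {a : Matrix (Fin π.dim) (Fin π.dim) X} (ha : a ∈ adFixedPoints α (Y : Set X) π)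
    (hann : ∀ b ∈ spectralIdeal F α (Y : Set X) π, a * b = 0) {j : X}
    (hj : j ∈ closedFixedPointIdeal F α ((Y : Set X) ∩ fixedPoints α))
    {c : Matrix (Fin π.dim) (Fin π.dim) X} (hc : c ∈ spectralSubspace α Set.univ π)
    (i k : Fin π.dim) : (a.conjTranspose * c.conjTranspose) i k * j = 0 := by
  -- Quantifying over all $c$ makes this stable on the left under $x\in X^\alpha$: $a^*c^*(1\otimes
  -- x)=a^*((1\otimes x^*)c)^*$, and $(1\otimes x^*)c$ is again in $X_2(\pi)$.
  let N : Submodule ℂ X :=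
    { carrier := {j | ∀ c ∈ spectralSubspace α Set.univ π, ∀ i k : Fin π.dim,
        (a.conjTranspose * c.conjTranspose) i k * j = 0}
      add_mem' := fun hx hy c hc i k => by rw [mul_add, hx c hc i k, hy c hc i k, add_zero]
      zero_mem' := fun c _ i k => mul_zero _
      smul_mem' := fun z x hx c hc i k => by rw [mul_smul_comm, hx c hc i k, smul_zero] }
  have hN : closedFixedPointIdeal F α ((Y : Set X) ∩ fixedPoints α) ≤ N := by
    refine closedFixedPointIdeal_le ?_ ?_ (fun x hx n hn c hc i k => ?_)
      fun x hx n hn c hc i k => ?_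
    · exact fun y hy c hc i k =>
        hY.conjTranspose_mul_conjTranspose_mul_eq_zero ha hann hc hy.1 hy.2 i k
    · have heq : (N : Set X) = ⋂ p : spectralSubspace α Set.univ π × Fin π.dim × Fin π.dim,
          {j | (a.conjTranspose * p.1.1.conjTranspose) p.2.1 p.2.2 * j = 0} := by
        ext j
        simp only [Set.mem_iInter, Set.mem_ofPred_eq]
        exact ⟨fun h p => h p.1.1 p.1.2 p.2.1 p.2.2, fun h c hc i k => h (⟨c, hc⟩, i, k)⟩
      rw [heq]
      exact @isClosed_iInter _ _ (weakTop F) _ fun p =>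
        hα.isDualPair.isClosed_setOf_eq_zero (hα.continuous_mul_left _)
    · have h := hn _ (diagonal_mul_mem_spectralSubspace hc (star_mem_fixedPoints hx)) i k
      rw [Matrix.conjTranspose_mul, ← Matrix.mul_assoc, Matrix.diagonal_conjTranspose,
        Matrix.mul_diagonal] at h
      simpa [mul_assoc] using h
    · rw [← mul_assoc, hn c hc i k, zero_mul]
  exact hN hj c hc i k

/-- An annihilating $a$ has entries in $Y$, not necessarily in the corner. Compressing $a^*$ by
elements of $Y^\alpha\subseteq J$ moves it into the corner, and enough compressions exist to recover
$a$. -/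
theorem IsInvariantHereditary.isEssentialIn_of_idealCorner [IsTopologicalGroup G] [CompactSpace G]
    [T2Space G] (hα : IsFDynamicalSystem F α) (hY : IsInvariantHereditary F α Y)
    (h : IsEssentialIn
      (spectralIdeal F α (idealCorner F
        (closedFixedPointIdeal F α ((Y : Set X) ∩ fixedPoints α))) π)
      (adFixedPoints α (idealCorner F
        (closedFixedPointIdeal F α ((Y : Set X) ∩ fixedPoints α))) π)) :
    IsEssentialIn (spectralIdeal F α (Y : Set X) π) (adFixedPoints α (Y : Set X) π) := by
  intro a ha hann
  set J := closedFixedPointIdeal F α ((Y : Set X) ∩ fixedPoints α) with hJ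
  have haJ := fun j (hj : j ∈ J) =>
    fun c hc => hY.mul_eq_zero_of_mem_closedFixedPointIdeal hα ha hann hj (c := c) hc
  have hbot : ∀ x ∈ Y, x ∈ fixedPoints α → ∀ y ∈ Y, y ∈ fixedPoints α →
      Matrix.diagonal (fun _ => x) * a.conjTranspose * Matrix.diagonal (fun _ => y) = 0 := by
    intro x hx hxf y hy hyf
    have hxJ : x ∈ J := subset_closedFixedPointIdeal _ ⟨hx, hxf⟩
    have hyJ : y ∈ J := subset_closedFixedPointIdeal _ ⟨hy, hyf⟩
    set e := Matrix.diagonal (fun _ => x) * a.conjTranspose * Matrix.diagonal (fun _ => y) with he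
    have hmem : e ∈ adFixedPoints α (idealCorner F J) π :=
      diagonal_mul_mul_diagonal_mem_adFixedPoints (conjTranspose_mem_adFixedPoints ha) hxf hyf
        fun z _ => mul_mul_mem_idealCorner hxJ z hyJ
    refine h e hmem fun b hb => hα.mul_eq_zero_of_mem_spectralIdeal (fun c hc => ?_) hb
    have hcX := spectralSubspace_mono (Set.subset_univ _) hc
    -- The right factor $y$ of $e$ is absorbed into $c$: $(1\otimes y)c^*=(c(1\otimes y^*))^*$.
    have hcy := mul_diagonal_mem_spectralSubspace hcX (star_mem_fixedPoints hyf)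
    have hentry : ∀ i k, (e * c.conjTranspose) i k
        = x * (a.conjTranspose *
            (c * Matrix.diagonal (fun _ => star y)).conjTranspose) i k := by
      intro i k
      rw [he, Matrix.mul_assoc, Matrix.mul_assoc, Matrix.diagonal_mul, Matrix.conjTranspose_mul,
        Matrix.conjTranspose_diagonal_const, star_star]
    have hEj : ∀ i k, ∀ j ∈ J, (e * c.conjTranspose) i k * j = 0 := fun i k j hj => by
      rw [hentry, mul_assoc, haJ j hj _ hcy, mul_zero]
    have hEz : ∀ i k, ∀ z ∈ idealCorner F J, (e * c.conjTranspose) i k * z = 0 := by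
      intro i k z hz
      have hsub : idealCorner F J ⊆
          (LinearMap.ker (LinearMap.mulLeft ℂ ((e * c.conjTranspose) i k)) : Set X) := by
        refine idealCorner_subset
          (hα.isDualPair.isClosed_setOf_eq_zero (hα.continuous_mul_left _)) fun j hj w l _ => ?_
        rw [LinearMap.mem_ker, LinearMap.mulLeft_apply, ← mul_assoc, ← mul_assoc, hEj i k j hj,
          zero_mul, zero_mul]
      exact hsub hz
    apply Matrix.eq_zero_of_mul_conjTranspose_eq_zero
    -- The entries of $c$ lie in the corner, which the entries of $ec^*$ annihilate because they
    -- annihilate $J$.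
    have hEc : e * c.conjTranspose * c = 0 := by
      ext i k
      rw [Matrix.mul_apply]
      exact Finset.sum_eq_zero fun l _ => hEz i l _ (hc.1 l k)
    rw [Matrix.conjTranspose_mul, Matrix.conjTranspose_conjTranspose, ← Matrix.mul_assoc, hEc,
      Matrix.zero_mul]
  have hexists := fun u (hu : u ∈ Y) (hu0 : u ≠ 0) =>
    hα.exists_fixedPoint_mul_ne_zero hY.invariant hY.isClosed hu hu0
  rw [← Matrix.conjTranspose_eq_zero]
  ext i k
  by_contra hne
  -- Fixed points are only known not to be annihilated from the left, so the second compression is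
  -- found after taking adjoints.
  obtain ⟨y, hy, hyf, hne'⟩ := hexists _ ((conjTranspose_mem_adFixedPoints ha).1 i k) hne
  obtain ⟨x, hx, hxf, hne''⟩ := hexists _
    (star_mem (mul_mem ((conjTranspose_mem_adFixedPoints ha).1 i k) hy)) (star_ne_zero.2 hne')
  have h1 := congrFun (congrFun (hbot _ (star_mem hx) (star_mem_fixedPoints hxf) y hy hyf) i) k
  rw [Matrix.mul_diagonal, Matrix.diagonal_mul] at h1
  refine hne'' (star_eq_zero.1 ?_)
  rw [star_mul, star_star, ← mul_assoc]
  exact h1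

end ConnesSpectrum

theorem theorem4p1 {X : Type*} [NonUnitalCStarAlgebra X] [PartialOrder X] [StarOrderedRing X]
    {G : Type*} [Group G] [TopologicalSpace G] [IsTopologicalGroup G] [CompactSpace G] [T2Space G]
    (F : Submodule ℂ (StrongDual ℂ X)) (α : G →* (X ≃⋆ₐ[ℂ] X)) (hα : IsFDynamicalSystem F α) :
    connesSpectrum F α =
      ⋂ (J : Submodule ℂ X) (_ : IsFixedPointIdeal F α J),
        arvesonSpectrum F α (idealCorner F J) := by
  refine subset_antisymm ?_ ?_
  · refine Set.subset_iInter₂ fun J hJ => ?_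
    exact Set.iInter₂_subset (hα.cornerSubalgebra hJ)
      (hα.isInvariantHereditary_cornerSubalgebra hJ)
  · refine Set.subset_iInter₂ fun Y hY π hπ => ?_
    obtain ⟨u, hu, hu0⟩ : ∃ u ∈ Y, u ≠ 0 := by
      by_contra! hzero
      refine hY.ne_bot (le_bot_iff.1 fun u hu => ?_)
      rw [hzero u hu]
      exact zero_mem _
    -- A nonzero fixed point in $Y$ makes the generated ideal nonzero, hence admissible in the
    -- intersection.
    obtain ⟨y, hy, hyf, hne⟩ := hα.exists_fixedPoint_mul_ne_zero hY.invariant hY.isClosed hu hu0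
    have hJ := hα.isFixedPointIdeal_closedFixedPointIdeal
      (S := (Y : Set X) ∩ fixedPoints α) Set.inter_subset_right ⟨hy, hyf⟩
      (right_ne_zero_of_mul hne)
    exact hY.isEssentialIn_of_idealCorner hα (Set.mem_iInter₂.1 hπ _ hJ)
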